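/- **Definitions.** Let $C$ be a binary matrix with $m\ge 1$ rows (the users) and finitely many columns (the options of all items). $C$ is a *P-matrix* if in each column the $1$'s are consecutive. A permutation $\sigma$ of the rows is a *C1P ordering* of $C$ if listing the rows as $\sigma(1),\sigma(2),\dots,\sigma(m)$ gives a P-matrix. $C$ is a *pre-P-matrix* if it has a C1P ordering. The C1P ordering is *unique* if any two C1P orderings are equal or reverse to each other. Let $C^{\mathrm{row}}$ and $C^{\mathrm{col}}$ be the row-normalized and the column-normalized matrix ($C_{jh}$ divided by the sum of row $j$, respectively of column $h$; zero columns stay zero), and let $U=C^{\mathrm{row}}(C^{\mathrm{col}})^{\top}$. Let $S\in\mathbb R^{(m-1)\times m}$, $(Ss)_j=s_{j+1}-s_j$, and $T\in\mathbb R^{m\times(m-1)}$, $(Td)_i=\sum_{j<i}d_j$. The algorithm HITSnDIFFs starts from user scores $s_0\in\mathbb R^m$, puts $d^{(0)}=Ss_0$ and iterates $$s\leftarrow T d^{(t)},\quad w\leftarrow (C^{\mathrm{col}})^{\top}s,\quad s\leftarrow C^{\mathrm{row}}w,\quad d\leftarrow Ss,\quad d^{(t+1)}\leftarrow d/\lVert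 d\rVert_2$$ (with $d^{(t+1)}=0$ if $d=0$); when stopped after $t$ iterations it returns the scores $Td^{(t)}$. A permutation $\sigma$ *sorts* a score vector $s$ if $s_{\sigma(1)},\dots,s_{\sigma(m)}$ is nondecreasing or nonincreasing. **Theorem.** There is an absolute constant $K$ such that the following holds. Let $C$ be a pre-P-matrix with a unique C1P ordering of its rows (up to reversal), all of whose rows have the same sum $r>0$. 1. (Reconstruction.) There is a proper linear subspace $W\subsetneq\mathbb R^m$, depending only on $C$, such that for every initial vector $s_0\in\mathbb R^m\setminus W$ (hence almost surely for a random initialization with a density) the sequence $d^{(t)}$ converges to some $d\in\mathbb R^{m-1}$, and the permutations that sort the scores $Td$ are exactly the C1P orderings of $C$; moreover there is $t_0$ such that for all $t\ge t_0$ the permutations that sort the returned scores $Td^{(t)}$ are exactly the C1P orderings of $C$. 2. (Running time.) On a real-number random access machine (unit cost for array accesses, for $+,-,\times,/,\sqrt{\phantom{x}}$ on reals, and for loop control), each iteration, executed by successive sparse matrix-vector products with $C^{\mathrm{col}}$ and $C^{\mathrm{row}}$ given as lists of their nonzero entries and with $T$ applied by cumulative summation, takes at most $K\cdot\mathrm{nnz}(C)$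 steps, where $\mathrm{nnz}$ is the number of nonzero entries. If instead the nonzero entries of $U$ are given (precomputed), each iteration, executed by a sparse product with $U$, takes at most $K\cdot\mathrm{nnz}(U)$ steps. Both programs compute exactly the iteration above and leave the stored matrix intact. -/

import Mathlib

open Filter Topology Matrix

noncomputable section

namespace HnD

/-! ### Matrices with the consecutive ones property -/

/-- A P-matrix: a binary matrix in each column of which the ones are consecutive. -/
def IsPMatrix {a b : ℕ} (A : Matrix (Fin a) (Fin b) ℝ) : Prop :=
  (∀ i h, A i h = 0 ∨ A i h = 1) ∧
    ∀ h, ∀ i j k : Fin a, i < j → j < k → A i h = 1 → A k h = 1 → A j h = 1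

/-- `σ` is a C1P ordering of the rows of `A`: listing row `σ 0`, then row `σ 1`, and so on,
gives a P-matrix. -/
def IsC1POrdering {a b : ℕ} (A : Matrix (Fin a) (Fin b) ℝ) (σ : Equiv.Perm (Fin a)) : Prop :=
  IsPMatrix (A.submatrix σ id)

/-- A pre-P-matrix: the rows can be permuted so that it becomes a P-matrix. -/
def IsPrePMatrix {a b : ℕ} (A : Matrix (Fin a) (Fin b) ℝ) : Prop :=
  ∃ σ : Equiv.Perm (Fin a), IsC1POrdering A σ

/-- There is at most one C1P ordering of the rows, where an ordering and its reverse are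
considered to be the same. -/
def C1POrderingUnique {a b : ℕ} (A : Matrix (Fin a) (Fin b) ℝ) : Prop :=
  ∀ σ τ : Equiv.Perm (Fin a), IsC1POrdering A σ → IsC1POrdering A τ →
    τ = σ ∨ ∀ i, τ i = σ i.rev

/-- Sorting the users by their scores (in increasing or in decreasing order) may result in the
list `σ 0, σ 1, …`. -/
def SortsScores {a : ℕ} (s : Fin a → ℝ) (σ : Equiv.Perm (Fin a)) : Prop :=
  Monotone (fun i => s (σ i)) ∨ Antitone (fun i => s (σ i))

/-- The number of nonzero entries of a matrix. -/
def nnz {a b : ℕ} (A : Matrix (Fin a) (Fin b) ℝ) : ℕ :=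
  Set.ncard {q : Fin a × Fin b | A q.1 q.2 ≠ 0}

/-! ### The algorithm, in matrix form (for `m + 1` users) -/

/-- The row-normalized matrix. -/
def rowNormalized {a b : ℕ} (C : Matrix (Fin a) (Fin b) ℝ) : Matrix (Fin a) (Fin b) ℝ :=
  Matrix.of fun i h => C i h / ∑ h', C i h'

/-- The column-normalized matrix (a zero column stays zero). -/
def colNormalized {a b : ℕ} (C : Matrix (Fin a) (Fin b) ℝ) : Matrix (Fin a) (Fin b) ℝ :=
  Matrix.of fun i h => C i h / ∑ i', C i' h

/-- The update matrix `U`. -/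
def updateMatrix {a b : ℕ} (C : Matrix (Fin a) (Fin b) ℝ) : Matrix (Fin a) (Fin a) ℝ :=
  rowNormalized C * (colNormalized C)ᵀ

/-- The matrix `S` of adjacent differences: `(S s) j = s (j + 1) - s j`. -/
def diffMatrix (m : ℕ) : Matrix (Fin m) (Fin (m + 1)) ℝ :=
  Matrix.of fun j i => if i = j.succ then 1 else if i = j.castSucc then -1 else 0

/-- The matrix `T` of partial sums: `(T d) i = d 0 + … + d (i - 1)`, so that `(T d) 0 = 0`. -/
def cumMatrix (m : ℕ) : Matrix (Fin (m + 1)) (Fin m) ℝ :=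
  Matrix.of fun i j => if j.castSucc < i then 1 else 0

/-- Scaling to Euclidean length one (the zero vector stays zero). -/
def normalize {m : ℕ} (d : Fin m → ℝ) : Fin m → ℝ :=
  fun j => d j / Real.sqrt (∑ i, d i * d i)

/-- One pass through the loop of HITSnDIFFs: score differences to scores, scores to option
weights, option weights to scores, scores to score differences, normalization. -/
def step {m b : ℕ} (C : Matrix (Fin (m + 1)) (Fin b) ℝ) (d : Fin m → ℝ) : Fin m → ℝ :=
  normalize (diffMatrix m *ᵥ (rowNormalized C *ᵥ ((colNormalized C)ᵀ *ᵥ (cumMatrix m *ᵥ d))))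

/-- The score differences after `t` passes, when started from the user scores `s₀`. -/
def diffs {m b : ℕ} (C : Matrix (Fin (m + 1)) (Fin b) ℝ) (s₀ : Fin (m + 1) → ℝ) (t : ℕ) :
    Fin m → ℝ :=
  (step C)^[t] (diffMatrix m *ᵥ s₀)

/-- The user scores that HITSnDIFFs returns when it stops after `t` passes. -/
def scores {m b : ℕ} (C : Matrix (Fin (m + 1)) (Fin b) ℝ) (s₀ : Fin (m + 1) → ℝ) (t : ℕ) :
    Fin (m + 1) → ℝ :=
  cumMatrix m *ᵥ diffs C s₀ t

/-! ### A random access machine over the reals, with a step count -/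

/-- Names of the arrays of natural numbers: coordinates of nonzero entries, and sizes. These
arrays are read-only. -/
inductive IdxArr
  | row | col | size

/-- Names of the arrays of real numbers. -/
inductive RealArr
  | diff | score | next | weight | norm | rowVal | colVal | updVal
  deriving DecidableEq

/-- The memory of the machine: loop counters, arrays of natural numbers, arrays of reals. -/
structure Mem where
  var : ℕ → ℕ
  idx : IdxArr → ℕ → ℕ
  real : RealArr → ℕ → ℝ

/-- Expressions for natural numbers. -/
inductive IExp
  | lit (n : ℕ)
  | var (x : ℕ)
  | succ (e : IExp)
  | load (a : IdxArr) (e : IExp)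

/-- Expressions for real numbers. -/
inductive RExp
  | zero
  | load (a : RealArr) (e : IExp)
  | add (e f : RExp)
  | sub (e f : RExp)
  | mul (e f : RExp)
  | div (e f : RExp)
  | sqrt (e : RExp)

/-- Commands: assignment to an array cell, composition, and the loop in which the counter `x`
runs through the natural numbers below `n`. -/
inductive Cmd
  | store (a : RealArr) (i : IExp) (e : RExp)
  | seq (p q : Cmd)
  | loop (x : ℕ) (n : IExp) (p : Cmd)

def IExp.eval (μ : Mem) : IExp → ℕ
  | .lit n => n
  | .var x => μ.var x
  | .succ e => e.eval μ + 1
  | .load a e => μ.idx a (e.eval μ)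

/-- Every constant, every access to a counter or to an array cell, and every increment takes
one step. -/
def IExp.cost : IExp → ℕ
  | .lit _ => 1
  | .var _ => 1
  | .succ e => e.cost + 1
  | .load _ e => e.cost + 1

def RExp.eval (μ : Mem) : RExp → ℝ
  | .zero => 0
  | .load a e => μ.real a (e.eval μ)
  | .add e f => e.eval μ + f.eval μ
  | .sub e f => e.eval μ - f.eval μ
  | .mul e f => e.eval μ * f.eval μ
  | .div e f => e.eval μ / f.eval μ
  | .sqrt e => Real.sqrt (e.eval μ)

/-- Every constant, every access to an array cell, and every arithmetic operation takes
one step. -/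
def RExp.cost : RExp → ℕ
  | .zero => 1
  | .load _ e => e.cost + 1
  | .add e f => e.cost + f.cost + 1
  | .sub e f => e.cost + f.cost + 1
  | .mul e f => e.cost + f.cost + 1
  | .div e f => e.cost + f.cost + 1
  | .sqrt e => e.cost + 1

/-- `p.run μ` is the memory after running `p` on the memory `μ`, together with the number of
steps taken. An assignment takes one step besides the evaluation of its expressions; a loop
takes one step for each pass besides the steps of its body, and one step to finish. -/
def Cmd.run : Cmd → Mem → Mem × ℕ
  | .store a i e, μ =>
      let arr := Function.update (μ.real a) (i.eval μ) (e.eval μ)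
      ({ μ with real := Function.update μ.real a arr }, i.cost + e.cost + 1)
  | .seq p q, μ =>
      let ν := p.run μ
      let ξ := q.run ν.1
      (ξ.1, ν.2 + ξ.2)
  | .loop x n p, μ =>
      (List.range (n.eval μ)).foldl
        (fun ν i =>
          let ξ := p.run { ν.1 with var := Function.update ν.1.var x i }
          (ξ.1, ν.2 + ξ.2 + 1))
        (μ, n.cost + 1)

/-! ### The algorithm as a program

Cell `0` of the array `size` holds `m` (one less than the number of users), cell `1` holds the
number of nonzero entries of the stored matrix. -/

/-- The counter used in the loops. -/
def ctr : IExp := .var 0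

/-- Repeat for each of the `m` positions in a vector of differences. -/
def forDiffs (p : Cmd) : Cmd := .loop 0 (.load .size (.lit 0)) p

/-- Repeat for each of the `m + 1` users. -/
def forUsers (p : Cmd) : Cmd := .loop 0 (.succ (.load .size (.lit 0))) p

/-- Repeat for each of the stored nonzero entries. -/
def forEntries (p : Cmd) : Cmd := .loop 0 (.load .size (.lit 1)) p

/-- `score ← T diff`, by cumulative summation. -/
def progCumSum : Cmd :=
  .seq (.store .score (.lit 0) .zero)
    (forDiffs (.store .score (.succ ctr) (.add (.load .score ctr) (.load .diff ctr))))

/-- `y[i] ← y[i] + v * x[j]` for each stored entry, where `v` is its value in the array `vals` and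
`i`, `j` are its coordinates in the arrays `out` and `inp`. -/
def progMulAdd (y : RealArr) (out : IdxArr) (vals : RealArr) (x : RealArr) (inp : IdxArr) : Cmd :=
  forEntries (.store y (.load out ctr)
    (.add (.load y (.load out ctr)) (.mul (.load vals ctr) (.load x (.load inp ctr)))))

/-- `diff ← S next`. -/
def progDiff : Cmd :=
  forDiffs (.store .diff ctr (.sub (.load .next (.succ ctr)) (.load .next ctr)))

/-- Normalize `diff` to be a unit vector. -/
def progNormalize : Cmd :=
  .seq (.store .norm (.lit 0) .zero)
    (.seq (forDiffs (.store .norm (.lit 0)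
        (.add (.load .norm (.lit 0)) (.mul (.load .diff ctr) (.load .diff ctr)))))
      (.seq (.store .norm (.lit 0) (.sqrt (.load .norm (.lit 0))))
        (forDiffs (.store .diff ctr (.div (.load .diff ctr) (.load .norm (.lit 0)))))))

/-- One pass through the loop of HITSnDIFFs, on the nonzero entries of the response matrix. -/
def progStep : Cmd :=
  .seq progCumSum
    (.seq (forEntries (.store .weight (.load .col ctr) .zero))
      (.seq (progMulAdd .weight .col .colVal .score .row)
        (.seq (forUsers (.store .next ctr .zero))
          (.seq (progMulAdd .next .row .rowVal .weight .col)
            (.seq progDiff progNormalize)))))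

/-- The same pass, on the nonzero entries of a precomputed update matrix `U`. -/
def progStepU : Cmd :=
  .seq progCumSum
    (.seq (forUsers (.store .next ctr .zero))
      (.seq (progMulAdd .next .row .updVal .score .col)
        (.seq progDiff progNormalize)))

/-- The arrays `row`, `col` and `vals` list the nonzero entries of `A`, each of them once, in
any order. -/
def StoresSparse {a b : ℕ} (μ : Mem) (vals : RealArr) (A : Matrix (Fin a) (Fin b) ℝ) : Prop :=
  ∃ e : Fin (μ.idx .size 1) ≃ {q : Fin a × Fin b // A q.1 q.2 ≠ 0},
    ∀ p : Fin (μ.idx .size 1), μ.idx .row p = (e p).1.1 ∧ μ.idx .col p = (e p).1.2 ∧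
      μ.real vals p = A (e p).1.1 (e p).1.2

/-- The memory holds the score differences `d`. -/
def StoresDiffs {m : ℕ} (μ : Mem) (d : Fin m → ℝ) : Prop :=
  μ.idx .size 0 = m ∧ ∀ j : Fin m, μ.real .diff j = d j

/-- The memory holds the score differences `d` and the response matrix `C`, the latter as the
list of the positions of its nonzero entries with the row-normalized and the
column-normalized values there. -/
def Stores {m b : ℕ} (μ : Mem) (C : Matrix (Fin (m + 1)) (Fin b) ℝ) (d : Fin m → ℝ) : Prop :=
  StoresDiffs μ d ∧ StoresSparse μ .rowVal (rowNormalized C) ∧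
    StoresSparse μ .colVal (colNormalized C)

/-- The memory holds the score differences `d` and the nonzero entries of the update matrix
of `C`. -/
def StoresU {m b : ℕ} (μ : Mem) (C : Matrix (Fin (m + 1)) (Fin b) ℝ) (d : Fin m → ℝ) : Prop :=
  StoresDiffs μ d ∧ StoresSparse μ .updVal (updateMatrix C)

end HnD

end

/-!
Let `U` be the update matrix, `S` the differences and `T` the partial sums.

*Convergence.* Since all rows of `C` have the same sum, `U` is symmetric and positive semidefinite,
and it fixes the constant vectors, which `S` kills. So the passes of the algorithm compute the
normalized vectors `S *ᵥ (U ^ t *ᵥ s₀)` (`diffs_succ_eq`). Let `l` be the largest eigenvalue of `U`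
that has a nonconstant eigenvector, and `π` the projection to its eigenspace. As no eigenvalue is
negative, power iteration converges to the normalization of `S *ᵥ π s₀` if `0 < l` and this vector is
not zero (`exists_dominant_projection`); `W` consists of the `s₀` for which it is zero. If `l = 0`,
which happens for at most two rows only, the differences vanish after one pass.

*Order.* Put the rows in a C1P ordering. The matrix `S * U * T` on score differences then has
nonnegative entries (`IsPMatrix.gapMatrix_nonneg`), and its entry at the gaps `(j, k)` is positive if
some column starts or ends at `j` and crosses `k` (`IsPMatrix.gapMatrix_pos`). If it were reducible,
there would be a proper closed set of gaps, and around a maximal run of gaps in this set one could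
reverse the rows without destroying the consecutive ones property, against the uniqueness of the
ordering (`IsPMatrix.eq_univ_of_closed`). A Perron-Frobenius argument
(`pos_or_neg_of_mulVec_eq_smul`) shows that all differences of a nonconstant eigenvector for `l`
have the same strict sign. So the limit scores, and by continuity all late ones, are strictly
monotone along the C1P ordering. With fewer than three rows there is nothing to sort.

*Running time.* Each loop of the programs has a single assignment as its body, so one invariant rule
(`run_loop_store`) gives both its effect and its step count. The total is linear in the number of
rows and the number of stored entries (`run_progStep`, `run_progStepU`); the former is at most the
latter, as `C` has a nonzero entry in each row, and `U` has a nonzero diagonal.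
-/

namespace HnD

/-! ### Differences, partial sums and normalization -/

theorem diffMatrix_mulVec {m : ℕ} (s : Fin (m + 1) → ℝ) (j : Fin m) :
    (diffMatrix m *ᵥ s) j = s j.succ - s j.castSucc := by
  have h : ∀ i : Fin (m + 1), diffMatrix m j i * s i =
      (if i = j.succ then s i else 0) - (if i = j.castSucc then s i else 0) := by
    intro i
    have hne : j.succ ≠ j.castSucc := (Fin.castSucc_lt_succ).ne'
    simp only [diffMatrix, Matrix.of_apply]
    split_ifs with h1 h2 <;> simp_all
  simp [Matrix.mulVec, dotProduct, h, Finset.sum_sub_distrib]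

theorem cumMatrix_mulVec {m : ℕ} (d : Fin m → ℝ) (i : Fin (m + 1)) :
    (cumMatrix m *ᵥ d) i = ∑ j, if j.castSucc < i then d j else 0 := by
  simp [Matrix.mulVec, dotProduct, cumMatrix]

theorem cumMatrix_mulVec_zero {m : ℕ} (d : Fin m → ℝ) : (cumMatrix m *ᵥ d) 0 = 0 := by
  simp [cumMatrix_mulVec]

theorem cumMatrix_mulVec_succ {m : ℕ} (d : Fin m → ℝ) (j : Fin m) :
    (cumMatrix m *ᵥ d) j.succ = (cumMatrix m *ᵥ d) j.castSucc + d j := by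
  have h : ∀ k : Fin m, (if k.castSucc < j.succ then d k else 0) =
      (if k.castSucc < j.castSucc then d k else 0) + if k = j then d k else 0 := by
    intro k
    rcases lt_trichotomy k j with h | h | h
    · simp [h, h.ne, Fin.castSucc_lt_succ_iff, h.le]
    · simp [h]
    · simp [h.not_gt, h.ne', Fin.castSucc_lt_succ_iff, h.not_ge]
  simp only [cumMatrix_mulVec, h, Finset.sum_add_distrib, Finset.sum_ite_eq', Finset.mem_univ,
    if_true]

theorem diffMatrix_mulVec_cumMatrix_mulVec {m : ℕ} (d : Fin m → ℝ) :
    diffMatrix m *ᵥ (cumMatrix m *ᵥ d) = d := by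
  ext j
  simp [diffMatrix_mulVec, cumMatrix_mulVec_succ]

theorem cumMatrix_mulVec_diffMatrix_mulVec {m : ℕ} (s : Fin (m + 1) → ℝ) (i : Fin (m + 1)) :
    (cumMatrix m *ᵥ (diffMatrix m *ᵥ s)) i = s i - s 0 := by
  induction i using Fin.induction with
  | zero => simp [cumMatrix_mulVec_zero]
  | succ j ih => rw [cumMatrix_mulVec_succ, ih, diffMatrix_mulVec]; ring

theorem normalize_smul {m : ℕ} {c : ℝ} (hc : 0 < c) (d : Fin m → ℝ) :
    normalize (c • d) = normalize d := by
  ext j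
  have h : ∑ i, (c • d) i * (c • d) i = c ^ 2 * ∑ i, d i * d i := by
    rw [Finset.mul_sum]
    exact Finset.sum_congr rfl fun i _ => by simp; ring
  simp only [normalize, h]
  rw [Real.sqrt_mul (by positivity), Real.sqrt_sq hc.le, Pi.smul_apply, smul_eq_mul,
    mul_div_mul_left _ _ hc.ne']

theorem normalize_zero {m : ℕ} : normalize (0 : Fin m → ℝ) = 0 := by
  ext j; simp [normalize]

theorem sum_mul_self_pos {m : ℕ} {d : Fin m → ℝ} (hd : d ≠ 0) : 0 < ∑ i, d i * d i := by
  obtain ⟨i, hi⟩ := Function.ne_iff.1 hd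
  exact Finset.sum_pos' (fun i _ => mul_self_nonneg _) ⟨i, Finset.mem_univ _, mul_self_pos.2 hi⟩

/-- Normalization is a positive rescaling; the scale of the zero vector is irrelevant. -/
theorem exists_normalize_eq_smul {m : ℕ} (d : Fin m → ℝ) :
    ∃ c : ℝ, 0 < c ∧ normalize d = c • d := by
  by_cases hd : d = 0
  · exact ⟨1, one_pos, by simp [hd, normalize_zero]⟩
  · refine ⟨(Real.sqrt (∑ i, d i * d i))⁻¹,
      inv_pos.2 (Real.sqrt_pos.2 (sum_mul_self_pos hd)), ?_⟩
    ext j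
    simp [normalize, div_eq_inv_mul]

theorem tendsto_normalize {m : ℕ} {d : Fin m → ℝ} (hd : d ≠ 0) :
    Tendsto normalize (𝓝 d) (𝓝 (normalize d)) := by
  refine tendsto_pi_nhds.2 fun j => ?_
  have hne : Real.sqrt (∑ i, d i * d i) ≠ 0 := (Real.sqrt_pos.2 (sum_mul_self_pos hd)).ne'
  have hc : ContinuousAt (fun x : Fin m → ℝ => x j / Real.sqrt (∑ i, x i * x i)) d :=
    ContinuousAt.div (continuous_apply j).continuousAt (Continuous.continuousAt (by fun_prop)) hne
  exact hc

/-! ### The update matrix -/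

theorem rowNormalized_apply {a b : ℕ} {C : Matrix (Fin a) (Fin b) ℝ} {r : ℝ}
    (hr : ∀ i, ∑ h, C i h = r) (i : Fin a) (h : Fin b) : rowNormalized C i h = C i h / r := by
  simp [rowNormalized, hr]

theorem updateMatrix_apply {a b : ℕ} {C : Matrix (Fin a) (Fin b) ℝ} {r : ℝ}
    (hr : ∀ i, ∑ h, C i h = r) (i j : Fin a) :
    updateMatrix C i j = ∑ h, C i h / r * (C j h / ∑ k, C k h) := by
  simp [updateMatrix, Matrix.mul_apply, rowNormalized_apply hr, colNormalized]

theorem updateMatrix_mulVec {a b : ℕ} (C : Matrix (Fin a) (Fin b) ℝ) (s : Fin a → ℝ) :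
    updateMatrix C *ᵥ s = rowNormalized C *ᵥ ((colNormalized C)ᵀ *ᵥ s) := by
  simp [updateMatrix, Matrix.mulVec_mulVec]

theorem updateMatrix_posSemidef {a b : ℕ} {C : Matrix (Fin a) (Fin b) ℝ} {r : ℝ}
    (hC : ∀ i h, 0 ≤ C i h) (hr0 : 0 < r) (hr : ∀ i, ∑ h, C i h = r) :
    (updateMatrix C).PosSemidef := by
  let B : Matrix (Fin a) (Fin b) ℝ := Matrix.of fun i h => C i h / Real.sqrt (r * ∑ k, C k h)
  have hB : updateMatrix C = B * Bᴴ := by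
    ext i j
    rw [updateMatrix_apply hr, Matrix.mul_apply]
    refine Finset.sum_congr rfl fun h _ => ?_
    have h0 : 0 ≤ r * ∑ k, C k h := mul_nonneg hr0.le (Finset.sum_nonneg fun k _ => hC k h)
    simp only [B, Matrix.of_apply, Matrix.conjTranspose_apply, star_trivial]
    rw [div_mul_div_comm, div_mul_div_comm, Real.mul_self_sqrt h0]
  rw [hB]
  exact Matrix.posSemidef_self_mul_conjTranspose B

theorem updateMatrix_mulVec_const {a b : ℕ} {C : Matrix (Fin a) (Fin b) ℝ} {r : ℝ}
    (hC : ∀ i h, 0 ≤ C i h) (hr0 : 0 < r) (hr : ∀ i, ∑ h, C i h = r) (c : ℝ) :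
    updateMatrix C *ᵥ (fun _ => c) = fun _ => c := by
  ext i
  have h1 : ∀ h, ∑ j, C i h / r * (C j h / ∑ k, C k h) = C i h / r := by
    intro h
    rw [← Finset.mul_sum, ← Finset.sum_div]
    by_cases h0 : ∑ k, C k h = 0
    · have := (Finset.sum_eq_zero_iff_of_nonneg fun k _ => hC k h).1 h0 i (Finset.mem_univ _)
      simp [this]
    · rw [div_self h0, mul_one]
  have h2 : ∑ j, updateMatrix C i j = 1 := by
    simp only [updateMatrix_apply hr]
    rw [Finset.sum_comm]
    simp only [h1, ← Finset.sum_div, hr, div_self hr0.ne']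
  simp [Matrix.mulVec, dotProduct, ← Finset.sum_mul, h2]

theorem sum_submatrix_perm {a b : ℕ} (C : Matrix (Fin a) (Fin b) ℝ) (σ : Equiv.Perm (Fin a))
    (h : Fin b) : ∑ k, C (σ k) h = ∑ k, C k h := Equiv.sum_comp σ fun k => C k h

theorem updateMatrix_submatrix {a b : ℕ} (C : Matrix (Fin a) (Fin b) ℝ)
    (σ : Equiv.Perm (Fin a)) :
    updateMatrix (C.submatrix σ id) = (updateMatrix C).submatrix σ σ := by
  ext i j
  simp [updateMatrix, Matrix.mul_apply, rowNormalized, colNormalized, sum_submatrix_perm]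

theorem submatrix_perm_pow_mulVec {a : ℕ} (U : Matrix (Fin a) (Fin a) ℝ)
    (σ : Equiv.Perm (Fin a)) (t : ℕ) (x : Fin a → ℝ) :
    (U.submatrix σ σ) ^ t *ᵥ (x ∘ σ) = (U ^ t *ᵥ x) ∘ σ := by
  induction t with
  | zero => simp
  | succ t ih =>
    rw [pow_succ', pow_succ', ← Matrix.mulVec_mulVec, ih, ← Matrix.mulVec_mulVec]
    ext i
    exact Equiv.sum_comp σ fun k => U (σ i) k * (U ^ t *ᵥ x) k

/-- Passing from scores to differences and back only shifts the scores by a constant, which `U`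
preserves and `S` kills. -/
theorem diffMatrix_mulVec_mulVec_sub_const {m : ℕ}
    {U : Matrix (Fin (m + 1)) (Fin (m + 1)) ℝ} (hU : ∀ c : ℝ, U *ᵥ (fun _ => c) = fun _ => c)
    (s : Fin (m + 1) → ℝ) :
    diffMatrix m *ᵥ (U *ᵥ (cumMatrix m *ᵥ (diffMatrix m *ᵥ s))) = diffMatrix m *ᵥ (U *ᵥ s) := by
  have h : cumMatrix m *ᵥ (diffMatrix m *ᵥ s) = s - fun _ => s 0 :=
    funext fun i => cumMatrix_mulVec_diffMatrix_mulVec s i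
  rw [h, Matrix.mulVec_sub, hU]
  ext j
  simp [diffMatrix_mulVec]

theorem step_diffMatrix_mulVec {m b : ℕ} {C : Matrix (Fin (m + 1)) (Fin b) ℝ}
    (hU : ∀ c : ℝ, updateMatrix C *ᵥ (fun _ => c) = fun _ => c) (s : Fin (m + 1) → ℝ) :
    step C (diffMatrix m *ᵥ s) = normalize (diffMatrix m *ᵥ (updateMatrix C *ᵥ s)) := by
  rw [step, ← updateMatrix_mulVec, diffMatrix_mulVec_mulVec_sub_const hU]

/-- The normalizations along the way do not matter: the iteration computes the normalized
differences of `U ^ t *ᵥ s₀`. -/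
theorem diffs_succ_eq {m b : ℕ} {C : Matrix (Fin (m + 1)) (Fin b) ℝ}
    (hU : ∀ c : ℝ, updateMatrix C *ᵥ (fun _ => c) = fun _ => c) (s₀ : Fin (m + 1) → ℝ) (t : ℕ) :
    diffs C s₀ (t + 1) = normalize (diffMatrix m *ᵥ (updateMatrix C ^ (t + 1) *ᵥ s₀)) := by
  induction t with
  | zero => simp [diffs, step_diffMatrix_mulVec hU]
  | succ t ih =>
    have h1 : diffs C s₀ (t + 1 + 1) = step C (diffs C s₀ (t + 1)) := by
      simp [diffs, Function.iterate_succ_apply']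
    obtain ⟨c, hc, hn⟩ :=
      exists_normalize_eq_smul (diffMatrix m *ᵥ (updateMatrix C ^ (t + 1) *ᵥ s₀))
    rw [h1, ih, hn, ← Matrix.mulVec_smul, step_diffMatrix_mulVec hU, Matrix.mulVec_smul,
      Matrix.mulVec_smul, normalize_smul hc, pow_succ' _ (t + 1),
      Matrix.mulVec_mulVec _ (updateMatrix C)]

/-! ### Power iteration for a positive semidefinite matrix -/

/-- `S` need not be injective: only the eigenvectors of `U` that `S` does not kill matter for the
growth of `S *ᵥ (U ^ t *ᵥ s)`. The number `l` is the largest of their eigenvalues and `π` projects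
to its eigenspace. -/
theorem exists_dominant_projection {ι n : Type*} [Fintype ι] [Fintype n] [DecidableEq n]
    {U : Matrix n n ℝ} (hU : U.PosSemidef) {S : Matrix ι n ℝ} (hS : S ≠ 0) :
    ∃ l : ℝ, 0 ≤ l ∧ ∃ π : (n → ℝ) →ₗ[ℝ] (n → ℝ), (∀ s, U *ᵥ π s = l • π s) ∧
      (∃ s, S *ᵥ π s ≠ 0) ∧
      (0 < l → ∀ s, Tendsto (fun t : ℕ => l⁻¹ ^ t • (S *ᵥ (U ^ t *ᵥ s))) atTop
        (𝓝 (S *ᵥ π s))) ∧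
      (l = 0 → ∀ s, S *ᵥ (U *ᵥ s) = 0) := by
  classical
  let v : Module.Basis n ℝ (n → ℝ) :=
    hU.1.eigenvectorBasis.toBasis.map (WithLp.linearEquiv 2 ℝ (n → ℝ))
  let e : n → ℝ := hU.1.eigenvalues
  have hv : ∀ i, U *ᵥ v i = e i • v i := fun i => by
    simpa [v, e] using hU.1.mulVec_eigenvectorBasis i
  have he : ∀ i, 0 ≤ e i := hU.eigenvalues_nonneg
  have hpow : ∀ (t : ℕ) i, U ^ t *ᵥ v i = e i ^ t • v i := by
    intro t i
    induction t with
    | zero => simp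
    | succ t ih => rw [pow_succ', ← Matrix.mulVec_mulVec, ih, Matrix.mulVec_smul, hv, smul_smul,
        pow_succ]
  have hexp : ∀ (t : ℕ) (s : n → ℝ),
      S *ᵥ (U ^ t *ᵥ s) = ∑ i, (v.repr s i * e i ^ t) • (S *ᵥ v i) := by
    intro t s
    conv_lhs => rw [← v.sum_repr s]
    simp only [Matrix.mulVec_sum, Matrix.mulVec_smul, hpow, smul_smul]
  have hI : (Finset.univ.filter fun i => S *ᵥ v i ≠ 0).Nonempty := by
    by_contra hne
    rw [Finset.not_nonempty_iff_eq_empty, Finset.filter_eq_empty_iff] at hne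
    apply hS
    have : S.mulVecLin = 0 := v.ext fun i => by simpa using hne (Finset.mem_univ i)
    rw [← Matrix.toLin'_apply'] at this
    simpa using this
  -- `i₀` is a dominant index among those that `S` does not kill
  obtain ⟨i₀, hi₀, hmax⟩ := Finset.exists_max_image _ e hI
  simp only [Finset.mem_filter, Finset.mem_univ, true_and] at hi₀ hmax
  let π : (n → ℝ) →ₗ[ℝ] (n → ℝ) := v.constr ℝ fun i => if e i = e i₀ then v i else 0
  have hπ : ∀ s, π s = ∑ i, v.repr s i • if e i = e i₀ then v i else 0 :=
    fun s => by simp [π, Module.Basis.constr_apply_fintype]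
  refine ⟨e i₀, he i₀, π, fun s => ?_, ⟨v i₀, ?_⟩, fun hl s => ?_, fun hl s => ?_⟩
  · rw [hπ, Matrix.mulVec_sum, Finset.smul_sum]
    refine Finset.sum_congr rfl fun i _ => ?_
    rw [Matrix.mulVec_smul, smul_comm (e i₀)]
    split_ifs with h
    · rw [hv, h]
    · simp
  · rwa [show π (v i₀) = v i₀ by simp only [π, Module.Basis.constr_basis, if_true]]
  · have h1 : S *ᵥ π s = ∑ i, (v.repr s i * if e i = e i₀ then 1 else 0) • (S *ᵥ v i) := by
      rw [hπ, Matrix.mulVec_sum]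
      refine Finset.sum_congr rfl fun i _ => ?_
      split_ifs <;> simp [Matrix.mulVec_smul]
    have h2 : ∀ t : ℕ, (e i₀)⁻¹ ^ t • (S *ᵥ (U ^ t *ᵥ s)) =
        ∑ i, (v.repr s i * (e i / e i₀) ^ t) • (S *ᵥ v i) := by
      intro t
      rw [hexp, Finset.smul_sum]
      refine Finset.sum_congr rfl fun i _ => ?_
      rw [smul_smul, div_eq_mul_inv, mul_pow]
      congr 1; ring
    simp only [h1, h2]
    refine tendsto_finsetSum _ fun i _ => ?_
    by_cases h0 : S *ᵥ v i = 0
    · simp [h0]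
    refine Tendsto.smul_const (Tendsto.const_mul _ ?_) _
    split_ifs with h
    · refine tendsto_const_nhds.congr fun t => ?_
      rw [h, div_self hl.ne', one_pow]
    · refine tendsto_pow_atTop_nhds_zero_of_lt_one (div_nonneg (he i) hl.le) ?_
      rw [div_lt_one hl]
      exact lt_of_le_of_ne (hmax i h0) h
  · have := hexp 1 s
    rw [pow_one] at this
    rw [this]
    refine Finset.sum_eq_zero fun i _ => ?_
    by_cases h0 : S *ᵥ v i = 0
    · simp [h0]
    · have : e i = 0 := le_antisymm (hl ▸ hmax i h0) (he i)
      simp [this]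

/-! ### The iteration matrix of a P-matrix -/

/-- The matrix that the iteration applies to score differences. Its indices `j : Fin m` stand for
the gaps between the consecutive rows `j.castSucc` and `j.succ`. -/
noncomputable def gapMatrix {m b : ℕ} (A : Matrix (Fin (m + 1)) (Fin b) ℝ) :
    Matrix (Fin m) (Fin m) ℝ :=
  diffMatrix m * updateMatrix A * cumMatrix m

theorem gapMatrix_mulVec_diffMatrix_mulVec {m b : ℕ} {A : Matrix (Fin (m + 1)) (Fin b) ℝ}
    (hU : ∀ c : ℝ, updateMatrix A *ᵥ (fun _ => c) = fun _ => c) (s : Fin (m + 1) → ℝ) :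
    gapMatrix A *ᵥ (diffMatrix m *ᵥ s) = diffMatrix m *ᵥ (updateMatrix A *ᵥ s) := by
  rw [gapMatrix, ← Matrix.mulVec_mulVec, ← Matrix.mulVec_mulVec,
    diffMatrix_mulVec_mulVec_sub_const hU]

/-- The fraction of the ones of the column `h` that lie beyond the gap `k`. -/
noncomputable def tailFraction {m b : ℕ} (A : Matrix (Fin (m + 1)) (Fin b) ℝ) (h : Fin b)
    (k : Fin m) : ℝ :=
  (∑ i, if k.castSucc < i then A i h else 0) / ∑ i, A i h

theorem gapMatrix_apply {m b : ℕ} {A : Matrix (Fin (m + 1)) (Fin b) ℝ} {r : ℝ}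
    (hr : ∀ i, ∑ h, A i h = r) (j k : Fin m) :
    gapMatrix A j k = ∑ h, (A j.succ h - A j.castSucc h) / r * tailFraction A h k := by
  have h1 : ∀ i, (updateMatrix A * cumMatrix m) i k = ∑ h, A i h / r * tailFraction A h k := by
    intro i
    simp only [Matrix.mul_apply, updateMatrix_apply hr, Finset.sum_mul]
    rw [Finset.sum_comm]
    refine Finset.sum_congr rfl fun h _ => ?_
    rw [tailFraction, Finset.sum_div, Finset.mul_sum]
    refine Finset.sum_congr rfl fun x _ => ?_
    simp only [cumMatrix, Matrix.of_apply]
    split_ifs <;> simp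
  have h2 : gapMatrix A j k =
      (diffMatrix m *ᵥ fun i => (updateMatrix A * cumMatrix m) i k) j := by
    rw [gapMatrix, Matrix.mul_assoc]; rfl
  rw [h2, diffMatrix_mulVec, h1, h1, ← Finset.sum_sub_distrib]
  exact Finset.sum_congr rfl fun h _ => by ring

theorem IsPMatrix.nonneg {a b : ℕ} {A : Matrix (Fin a) (Fin b) ℝ} (hA : IsPMatrix A)
    (i : Fin a) (h : Fin b) : 0 ≤ A i h := by
  rcases hA.1 i h with h | h <;> simp [h]

theorem tailFraction_nonneg {m b : ℕ} {A : Matrix (Fin (m + 1)) (Fin b) ℝ}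
    (hA : ∀ i h, 0 ≤ A i h) (h : Fin b) (k : Fin m) : 0 ≤ tailFraction A h k :=
  div_nonneg (Finset.sum_nonneg fun i _ => by split_ifs <;> simp [hA])
    (Finset.sum_nonneg fun i _ => hA i h)

theorem tailFraction_le_one {m b : ℕ} {A : Matrix (Fin (m + 1)) (Fin b) ℝ}
    (hA : ∀ i h, 0 ≤ A i h) (h : Fin b) (k : Fin m) : tailFraction A h k ≤ 1 :=
  div_le_one_of_le₀ (Finset.sum_le_sum fun i _ => by split_ifs <;> simp [hA])
    (Finset.sum_nonneg fun i _ => hA i h)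

theorem tailFraction_pos {m b : ℕ} {A : Matrix (Fin (m + 1)) (Fin b) ℝ}
    (hA : ∀ i h, 0 ≤ A i h) {h : Fin b} {k : Fin m} {i : Fin (m + 1)} (hi : k.castSucc < i)
    (hAi : 0 < A i h) : 0 < tailFraction A h k :=
  div_pos (Finset.sum_pos' (fun i _ => by split_ifs <;> simp [hA])
      ⟨i, Finset.mem_univ _, by simpa [hi] using hAi⟩)
    (Finset.sum_pos' (fun i _ => hA i h) ⟨i, Finset.mem_univ _, hAi⟩)

theorem tailFraction_lt_one {m b : ℕ} {A : Matrix (Fin (m + 1)) (Fin b) ℝ}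
    (hA : ∀ i h, 0 ≤ A i h) {h : Fin b} {k : Fin m} {i : Fin (m + 1)} (hi : i ≤ k.castSucc)
    (hAi : 0 < A i h) : tailFraction A h k < 1 := by
  rw [tailFraction, div_lt_one (Finset.sum_pos' (fun i _ => hA i h) ⟨i, Finset.mem_univ _, hAi⟩)]
  exact Finset.sum_lt_sum (fun i _ => by split_ifs <;> simp [hA])
    ⟨i, Finset.mem_univ _, by simpa [hi.not_gt] using hAi⟩

theorem tailFraction_eq_zero {m b : ℕ} {A : Matrix (Fin (m + 1)) (Fin b) ℝ} {h : Fin b}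
    {k : Fin m} (hz : ∀ i, k.castSucc < i → A i h = 0) : tailFraction A h k = 0 := by
  rw [tailFraction, Finset.sum_eq_zero fun i _ => ite_eq_right_iff.2 (hz i), zero_div]

theorem tailFraction_eq_one {m b : ℕ} {A : Matrix (Fin (m + 1)) (Fin b) ℝ}
    (hA : ∀ i h, 0 ≤ A i h) {h : Fin b} {k : Fin m} {i : Fin (m + 1)} (hAi : 0 < A i h)
    (hz : ∀ i, i ≤ k.castSucc → A i h = 0) : tailFraction A h k = 1 := by
  have : ∀ i, (if k.castSucc < i then A i h else 0) = A i h := fun i => by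
    split_ifs with hi
    · rfl
    · exact (hz i (not_lt.1 hi)).symm
  rw [tailFraction]
  simp only [this]
  exact div_self (Finset.sum_pos' (fun i _ => hA i h) ⟨i, Finset.mem_univ _, hAi⟩).ne'

/-- If a column starts at the gap `j ≤ k`, its term is nonnegative; if it ends there, it has no
ones beyond `k`, and its term vanishes. -/
theorem IsPMatrix.sub_mul_tailFraction_nonneg {m b : ℕ} {A : Matrix (Fin (m + 1)) (Fin b) ℝ}
    (hA : IsPMatrix A) {j k : Fin m} (hjk : j ≤ k) (h : Fin b) :
    0 ≤ (A j.succ h - A j.castSucc h) * tailFraction A h k := by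
  rcases hA.1 j.castSucc h with h0 | h1
  · rw [h0, sub_zero]
    exact mul_nonneg (hA.nonneg _ _) (tailFraction_nonneg hA.nonneg _ _)
  · rcases hA.1 j.succ h with h0' | h1'
    · rw [tailFraction_eq_zero, mul_zero]
      intro i hi
      refine (hA.1 i h).resolve_right fun hi1 => ?_
      rcases (show j.succ ≤ i from (Fin.castSucc_lt_iff_succ_le).1
        (lt_of_le_of_lt (Fin.castSucc_le_castSucc_iff.2 hjk) hi)).eq_or_lt with he | hlt
      · rw [← he, h0'] at hi1; exact zero_ne_one hi1
      · have := hA.2 h j.castSucc j.succ i Fin.castSucc_lt_succ hlt h1 hi1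
        rw [h0'] at this; exact zero_ne_one this
    · simp [h1, h1']

/-- The mirror image of `IsPMatrix.sub_mul_tailFraction_nonneg`, for gaps `k ≤ j`. -/
theorem IsPMatrix.sub_mul_one_sub_tailFraction_nonneg {m b : ℕ}
    {A : Matrix (Fin (m + 1)) (Fin b) ℝ} (hA : IsPMatrix A) {j k : Fin m} (hkj : k ≤ j)
    (h : Fin b) : 0 ≤ (A j.castSucc h - A j.succ h) * (1 - tailFraction A h k) := by
  rcases hA.1 j.succ h with h0 | h1
  · rw [h0, sub_zero]
    exact mul_nonneg (hA.nonneg _ _) (sub_nonneg.2 (tailFraction_le_one hA.nonneg _ _))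
  · rcases hA.1 j.castSucc h with h0' | h1'
    · rw [tailFraction_eq_one hA.nonneg (by rw [h1]; exact one_pos), sub_self, mul_zero]
      intro i hi
      refine (hA.1 i h).resolve_right fun hi1 => ?_
      rcases (hi.trans (Fin.castSucc_le_castSucc_iff.2 hkj)).eq_or_lt with he | hlt
      · rw [he, h0'] at hi1; exact zero_ne_one hi1
      · have := hA.2 h i j.castSucc j.succ hlt Fin.castSucc_lt_succ hi1 h1
        rw [h0'] at this; exact zero_ne_one this
    · simp [h1, h1']

theorem gapMatrix_eq_sum_tail {m b : ℕ} {A : Matrix (Fin (m + 1)) (Fin b) ℝ} {r : ℝ}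
    (hr : ∀ i, ∑ h, A i h = r) (j k : Fin m) :
    gapMatrix A j k = (∑ h, (A j.succ h - A j.castSucc h) * tailFraction A h k) / r := by
  rw [gapMatrix_apply hr, Finset.sum_div]
  exact Finset.sum_congr rfl fun h _ => by ring

/-- As the rows `j` and `j + 1` have the same sum, tail fractions may be replaced by the fractions
of the ones that lie before the gap. -/
theorem gapMatrix_eq_sum_head {m b : ℕ} {A : Matrix (Fin (m + 1)) (Fin b) ℝ} {r : ℝ}
    (hr : ∀ i, ∑ h, A i h = r) (j k : Fin m) :
    gapMatrix A j k = (∑ h, (A j.castSucc h - A j.succ h) * (1 - tailFraction A h k)) / r := by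
  have h1 : ∑ h, (A j.castSucc h - A j.succ h) * (1 - tailFraction A h k) =
      (∑ h, A j.castSucc h - ∑ h, A j.succ h) +
        ∑ h, (A j.succ h - A j.castSucc h) * tailFraction A h k := by
    rw [← Finset.sum_sub_distrib, ← Finset.sum_add_distrib]
    exact Finset.sum_congr rfl fun h _ => by ring
  rw [gapMatrix_eq_sum_tail hr, h1, hr, hr, sub_self, zero_add]

theorem IsPMatrix.gapMatrix_nonneg {m b : ℕ} {A : Matrix (Fin (m + 1)) (Fin b) ℝ} {r : ℝ}
    (hA : IsPMatrix A) (hr0 : 0 < r) (hr : ∀ i, ∑ h, A i h = r) (j k : Fin m) :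
    0 ≤ gapMatrix A j k := by
  rcases le_total j k with hjk | hkj
  · rw [gapMatrix_eq_sum_tail hr]
    exact div_nonneg (Finset.sum_nonneg fun h _ => hA.sub_mul_tailFraction_nonneg hjk h) hr0.le
  · rw [gapMatrix_eq_sum_head hr]
    exact div_nonneg
      (Finset.sum_nonneg fun h _ => hA.sub_mul_one_sub_tailFraction_nonneg hkj h) hr0.le

/-- A column that starts or ends at the gap `j` and has ones on both sides of the gap `k` makes
the entry at `(j, k)` positive. -/
theorem IsPMatrix.gapMatrix_pos {m b : ℕ} {A : Matrix (Fin (m + 1)) (Fin b) ℝ} {r : ℝ}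
    (hA : IsPMatrix A) (hr0 : 0 < r) (hr : ∀ i, ∑ h, A i h = r) {j k : Fin m} {h : Fin b}
    (hj : A j.castSucc h ≠ A j.succ h) (hk : A k.castSucc h = 1) (hk' : A k.succ h = 1) :
    0 < gapMatrix A j k := by
  rcases lt_trichotomy j k with hjk | rfl | hkj
  · have h0 : A j.castSucc h = 0 := by
      refine (hA.1 _ _).resolve_right fun h1 => hj ?_
      rw [h1, hA.2 h j.castSucc j.succ k.succ Fin.castSucc_lt_succ
        (Fin.succ_lt_succ_iff.2 hjk) h1 hk']
    have h1 : A j.succ h = 1 := (hA.1 _ _).resolve_left fun h0' => hj (h0.trans h0'.symm)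
    rw [gapMatrix_eq_sum_tail hr]
    refine div_pos (Finset.sum_pos' (fun h _ => hA.sub_mul_tailFraction_nonneg hjk.le h)
      ⟨h, Finset.mem_univ _, ?_⟩) hr0
    rw [h0, h1, sub_zero, one_mul]
    exact tailFraction_pos hA.nonneg Fin.castSucc_lt_succ (by rw [hk']; exact one_pos)
  · exact absurd (hk.trans hk'.symm) hj
  · have h0 : A j.succ h = 0 := by
      refine (hA.1 _ _).resolve_right fun h1 => hj ?_
      rw [h1, hA.2 h k.castSucc j.castSucc j.succ (Fin.castSucc_lt_castSucc_iff.2 hkj)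
        Fin.castSucc_lt_succ hk h1]
    have h1 : A j.castSucc h = 1 := (hA.1 _ _).resolve_left fun h0' => hj (h0'.trans h0.symm)
    rw [gapMatrix_eq_sum_head hr]
    refine div_pos (Finset.sum_pos'
      (fun h _ => hA.sub_mul_one_sub_tailFraction_nonneg hkj.le h)
      ⟨h, Finset.mem_univ _, ?_⟩) hr0
    rw [h0, h1, sub_zero, one_mul, sub_pos]
    exact tailFraction_lt_one hA.nonneg le_rfl (by rw [hk]; exact one_pos)

/-! ### Uniqueness of the ordering makes the iteration matrix irreducible -/

/-- The permutation that reverses the block of rows `p, …, q`. -/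
def reverseBlock {n : ℕ} (p q : Fin n) : Equiv.Perm (Fin n) :=
  Function.Involutive.toPerm
    (fun i => if h : p ≤ i ∧ i ≤ q then ⟨p + q - i, by omega⟩ else i) (by
      intro i
      by_cases h : p ≤ i ∧ i ≤ q
      · have h' : p.val ≤ p.val + q.val - i.val ∧ p.val + q.val - i.val ≤ q.val := by omega
        simp only [h, and_self, dite_true, Fin.le_def, h']
        ext; simp only; omega
      · simp [h])

theorem reverseBlock_of_mem {n : ℕ} {p q i : Fin n} (h : p ≤ i ∧ i ≤ q) :
    (reverseBlock p q i : ℕ) = p + q - i :=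
  congrArg Fin.val (dif_pos h)

theorem reverseBlock_of_not_mem {n : ℕ} {p q i : Fin n} (h : ¬(p ≤ i ∧ i ≤ q)) :
    reverseBlock p q i = i :=
  dif_neg h

/-- Every column is constant on the block or has all its ones in the block: then reversing the
block keeps the ones of the column consecutive. -/
theorem IsPMatrix.isC1POrdering_reverseBlock {a b : ℕ} {A : Matrix (Fin a) (Fin b) ℝ}
    (hA : IsPMatrix A) {p q : Fin a}
    (hpq : ∀ h, (∀ i j, p ≤ i → i ≤ q → p ≤ j → j ≤ q → A i h = A j h) ∨
      ∀ i, A i h = 1 → p ≤ i ∧ i ≤ q) :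
    IsC1POrdering A (reverseBlock p q) := by
  have hmem : ∀ i, p ≤ i ∧ i ≤ q → p ≤ reverseBlock p q i ∧ reverseBlock p q i ≤ q := by
    intro i hi
    have := reverseBlock_of_mem hi
    simp only [Fin.le_def] at hi ⊢
    omega
  have hmem' : ∀ i, p ≤ reverseBlock p q i ∧ reverseBlock p q i ≤ q → p ≤ i ∧ i ≤ q := by
    intro i hi
    by_contra hn
    rw [reverseBlock_of_not_mem hn] at hi
    exact hn hi
  refine ⟨fun i h => hA.1 _ _, fun h i j k hij hjk hi hk => ?_⟩
  simp only [Matrix.submatrix_apply, id] at hi hk ⊢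
  rcases hpq h with hc | hin
  · have hsame : ∀ x, A (reverseBlock p q x) h = A x h := by
      intro x
      by_cases hx : p ≤ x ∧ x ≤ q
      · exact hc _ _ (hmem x hx).1 (hmem x hx).2 hx.1 hx.2
      · rw [reverseBlock_of_not_mem hx]
    rw [hsame] at hi hk ⊢
    exact hA.2 h i j k hij hjk hi hk
  · have hi' := hmem' i (hin _ hi)
    have hk' := hmem' k (hin _ hk)
    have hj' : p ≤ j ∧ j ≤ q := ⟨hi'.1.trans hij.le, hjk.le.trans hk'.2⟩
    have e1 := reverseBlock_of_mem hi'
    have e2 := reverseBlock_of_mem hj'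
    have e3 := reverseBlock_of_mem hk'
    refine hA.2 h (reverseBlock p q k) _ (reverseBlock p q i) ?_ ?_ hk hi <;>
      simp only [Fin.lt_def, Fin.le_def] at * <;> omega

/-- A nonempty set of gaps contains a run `p, …, q` whose neighbors, if any, lie outside it. -/
theorem exists_maximal_run {m : ℕ} {K : Set (Fin m)} (hK : K.Nonempty) :
    ∃ p q : Fin m, p ≤ q ∧ (∀ k, p ≤ k → k ≤ q → k ∈ K) ∧
      (∀ k : Fin m, (k : ℕ) + 1 = p → k ∉ K) ∧ (∀ k : Fin m, (k : ℕ) = q + 1 → k ∉ K) := by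
  classical
  obtain ⟨k₀, hk₀⟩ := hK
  obtain ⟨⟨p, q⟩, hmem, hmax⟩ := Finset.exists_max_image
    (Finset.univ.filter fun x : Fin m × Fin m =>
      x.1 ≤ x.2 ∧ ∀ k, x.1 ≤ k → k ≤ x.2 → k ∈ K)
    (fun x => (x.2 : ℕ) - x.1)
    ⟨(k₀, k₀), by
      simp only [Finset.mem_filter, Finset.mem_univ, true_and, le_refl]
      intro k h1 h2
      rwa [le_antisymm h2 h1]⟩
  simp only [Finset.mem_filter, Finset.mem_univ, true_and, Prod.forall] at hmem hmax
  have hpq : (p : ℕ) ≤ q := hmem.1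
  refine ⟨p, q, hmem.1, hmem.2, fun k hk hkK => ?_, fun k hk hkK => ?_⟩
  · have := hmax k q ⟨Fin.le_def.2 (by omega), fun x h1 h2 => ?_⟩
    · omega
    · rcases (Fin.le_def.1 h1).eq_or_lt with he | hlt
      · rwa [← Fin.ext he]
      · exact hmem.2 x (Fin.le_def.2 (by omega)) h2
  · have := hmax p k ⟨Fin.le_def.2 (by omega), fun x h1 h2 => ?_⟩
    · omega
    · rcases (Fin.le_def.1 h2).eq_or_lt with he | hlt
      · rwa [Fin.ext he]
      · exact hmem.2 x h1 (Fin.le_def.2 (by omega))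

/-- The matrix of the gaps is irreducible. If `K` were a proper closed set, then reversing the rows
around a maximal run of gaps in `K` would give a further C1P ordering: a column that has both values
on the block starts or ends inside it and hence cannot cross its ends, which are gaps outside
`K`. -/
theorem IsPMatrix.eq_univ_of_closed {m b : ℕ} {A : Matrix (Fin (m + 1)) (Fin b) ℝ} {r : ℝ}
    (hA : IsPMatrix A) (huniq : C1POrderingUnique A) (hr0 : 0 < r)
    (hr : ∀ i, ∑ h, A i h = r) {K : Set (Fin m)} (hne : K.Nonempty)
    (hK : ∀ j ∈ K, ∀ k ∉ K, gapMatrix A j k = 0) : K = Set.univ := by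
  obtain ⟨p, q, hpq, hrun, hleft, hright⟩ := exists_maximal_run hne
  have hcross : ∀ h, ∀ j, p ≤ j → j ≤ q → A j.castSucc h ≠ A j.succ h →
      ∀ k : Fin m, A k.castSucc h = 1 → A k.succ h = 1 → k ∈ K := by
    intro h j h1 h2 hj k hk hk'
    by_contra hkK
    exact (hA.gapMatrix_pos hr0 hr hj hk hk').ne' (hK j (hrun j h1 h2) k hkK)
  have hblock : ∀ h, (∀ i j, p.castSucc ≤ i → i ≤ q.succ → p.castSucc ≤ j → j ≤ q.succ →
      A i h = A j h) ∨ ∀ i, A i h = 1 → p.castSucc ≤ i ∧ i ≤ q.succ := by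
    intro h
    by_cases hconst : ∀ j, p ≤ j → j ≤ q → A j.castSucc h = A j.succ h
    · left
      have key : ∀ i, p.castSucc ≤ i → i ≤ q.succ → A i h = A p.castSucc h := by
        intro i
        induction i using Fin.induction with
        | zero =>
          intro h1 _
          rw [le_antisymm h1 (Fin.zero_le _)]
        | succ j ih =>
          intro h1 h2
          rcases h1.eq_or_lt with he | hlt
          · rw [he]
          · have hpj : p.castSucc ≤ j.castSucc := by
              simp only [Fin.lt_def, Fin.le_def, Fin.val_succ, Fin.val_castSucc] at *; omega
            have hjq : j.castSucc ≤ q.succ := Fin.castSucc_lt_succ.le.trans h2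
            rw [← hconst j (Fin.castSucc_le_castSucc_iff.1 hpj) (Fin.succ_le_succ_iff.1 h2),
              ih hpj hjq]
      intro i j h1 h2 h3 h4
      rw [key i h1 h2, key j h3 h4]
    · right
      push Not at hconst
      obtain ⟨j, hpj, hjq, hj⟩ := hconst
      -- a row of the block in which the column has a one
      obtain ⟨y, hpy, hyq, hy⟩ : ∃ y, p.castSucc ≤ y ∧ y ≤ q.succ ∧ A y h = 1 := by
        rcases hA.1 j.castSucc h with h0 | h1
        · refine ⟨j.succ, ?_, Fin.succ_le_succ_iff.2 hjq,
            (hA.1 _ _).resolve_left fun h0' => hj (h0.trans h0'.symm)⟩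
          exact (Fin.castSucc_le_castSucc_iff.2 hpj).trans Fin.castSucc_lt_succ.le
        · refine ⟨j.castSucc, Fin.castSucc_le_castSucc_iff.2 hpj, ?_, h1⟩
          exact Fin.castSucc_lt_succ.le.trans (Fin.succ_le_succ_iff.2 hjq)
      have hbetween : ∀ u v w : Fin (m + 1), u ≤ v → v ≤ w → A u h = 1 → A w h = 1 →
          A v h = 1 := by
        intro u v w h1 h2 hu hw
        rcases h1.eq_or_lt with rfl | h1
        · exact hu
        rcases h2.eq_or_lt with rfl | h2
        · exact hw
        exact hA.2 h u v w h1 h2 hu hw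
      intro i hi
      by_contra hout
      rcases not_and_or.1 hout with hlt | hgt
      · rw [not_le] at hlt
        have hp0 : 0 < p.val := by simp only [Fin.lt_def, Fin.val_castSucc] at hlt; omega
        let k : Fin m := ⟨p - 1, by omega⟩
        refine hleft k (Nat.sub_add_cancel hp0) (hcross h j hpj hjq hj k ?_ ?_)
        · refine hbetween i _ y ?_ ?_ hi hy <;>
            simp only [k, Fin.lt_def, Fin.le_def, Fin.val_castSucc] at * <;> omega
        · refine hbetween i _ y ?_ ?_ hi hy <;>
            simp only [k, Fin.lt_def, Fin.le_def, Fin.val_castSucc, Fin.val_succ] at * <;> omega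
      · rw [not_le] at hgt
        have hqm : q.val + 1 < m := by simp only [Fin.lt_def, Fin.val_succ] at hgt; omega
        let k : Fin m := ⟨q + 1, hqm⟩
        refine hright k rfl (hcross h j hpj hjq hj k ?_ ?_)
        · refine hbetween y _ i ?_ ?_ hy hi <;>
            simp only [k, Fin.lt_def, Fin.le_def, Fin.val_castSucc, Fin.val_succ] at * <;> omega
        · refine hbetween y _ i ?_ ?_ hy hi <;>
            simp only [k, Fin.lt_def, Fin.le_def, Fin.val_castSucc, Fin.val_succ] at * <;> omega
  have hone : IsC1POrdering A 1 := by simpa [IsC1POrdering] using hA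
  have hpq' : (p : ℕ) ≤ q := hpq
  have hp := p.isLt
  have hq := q.isLt
  rcases huniq 1 _ hone (hA.isC1POrdering_reverseBlock hblock) with h1 | hrev
  · -- a block of at least two rows is not fixed by its reversal
    have h2 := reverseBlock_of_mem (p := p.castSucc) (q := q.succ) (i := p.castSucc)
      ⟨le_rfl, by simp only [Fin.le_def, Fin.val_castSucc, Fin.val_succ]; omega⟩
    rw [h1] at h2
    simp only [Equiv.Perm.coe_one, id, Fin.val_castSucc, Fin.val_succ] at h2
    omega
  · -- the full reversal exchanges the first and the last row, so both lie in the block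
    have hmem : ∀ i : Fin (m + 1), i.rev ≠ i → p.castSucc ≤ i ∧ i ≤ q.succ := by
      intro i hi
      by_contra hn
      have := hrev i
      rw [reverseBlock_of_not_mem hn] at this
      exact hi this.symm
    have h0 := (hmem 0 (by simp [Fin.ext_iff]; omega)).1
    have hl := (hmem (Fin.last m) (by simp [Fin.ext_iff]; omega)).2
    simp only [Fin.le_def, Fin.val_castSucc, Fin.val_succ, Fin.val_zero, Fin.val_last] at h0 hl
    refine Set.eq_univ_of_forall fun k => hrun k ?_ ?_ <;> rw [Fin.le_def] <;> omega

/-! ### Dominant eigenvectors of an irreducible nonnegative matrix -/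

/-- Irreducibility, in the form that no proper nonempty set of indices is closed under the
transitions `j → k` with `M j k ≠ 0`, forces a nonnegative eigenvector to be zero or positive. -/
theorem eq_zero_or_pos_of_mulVec_eq_smul {ι : Type*} [Fintype ι] {M : Matrix ι ι ℝ}
    (hM : ∀ j k, 0 ≤ M j k)
    (hirr : ∀ K : Set ι, K.Nonempty → (∀ j ∈ K, ∀ k ∉ K, M j k = 0) → K = Set.univ) {l : ℝ}
    {x : ι → ℝ} (hx : ∀ j, 0 ≤ x j) (hMx : M *ᵥ x = l • x) : x = 0 ∨ ∀ j, 0 < x j := by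
  by_cases hne : {j | x j = 0}.Nonempty
  · left
    have huniv := hirr _ hne fun j (hj : x j = 0) k (hk : x k ≠ 0) => by
      have h0 : ∑ i, M j i * x i = 0 := by
        have := congrFun hMx j
        simpa [Matrix.mulVec, dotProduct, hj] using this
      have := (Finset.sum_eq_zero_iff_of_nonneg fun i _ => mul_nonneg (hM j i) (hx i)).1 h0 k
        (Finset.mem_univ k)
      exact (mul_eq_zero.1 this).resolve_right hk
    ext j
    exact huniv.ge (Set.mem_univ j)
  · right
    intro j
    exact lt_of_le_of_ne (hx j) fun h => hne ⟨j, h.symm⟩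

/-- Let `l` be the growth rate of the powers of `M`, in the sense that `l⁻¹ ^ t • M ^ t *ᵥ x`
converges to an eigenvector for every `x`. With `x = |d|` the limit `p` satisfies `|d| ≤ p`, because
`l • |d| ≤ M *ᵥ |d|`; so `p` is positive, and `d` is a multiple of `p`, because
`(d i / p i) • p - d` is nonnegative with a zero at the index `i` that maximizes `d i / p i`. -/
theorem pos_or_neg_of_mulVec_eq_smul {ι : Type*} [Fintype ι] [DecidableEq ι]
    {M : Matrix ι ι ℝ} (hM : ∀ j k, 0 ≤ M j k)
    (hirr : ∀ K : Set ι, K.Nonempty → (∀ j ∈ K, ∀ k ∉ K, M j k = 0) → K = Set.univ) {l : ℝ}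
    (hl : 0 < l)
    (hlim : ∀ x : ι → ℝ, ∃ p : ι → ℝ, M *ᵥ p = l • p ∧
      Tendsto (fun t : ℕ => l⁻¹ ^ t • (M ^ t *ᵥ x)) atTop (𝓝 p))
    {d : ι → ℝ} (hd : d ≠ 0) (hMd : M *ᵥ d = l • d) : (∀ j, 0 < d j) ∨ ∀ j, d j < 0 := by
  obtain ⟨p, hMp, hp⟩ := hlim fun j => |d j|
  have hmono : ∀ x y : ι → ℝ, x ≤ y → M *ᵥ x ≤ M *ᵥ y := fun x y hxy j =>
    Finset.sum_le_sum fun k _ => mul_le_mul_of_nonneg_left (hxy k) (hM j k)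
  have hstep : (l • fun j => |d j|) ≤ M *ᵥ fun j => |d j| := fun j => by
    have h1 : l * d j = ∑ k, M j k * d k := (congrFun hMd j).symm
    calc l * |d j| = |∑ k, M j k * d k| := by rw [← h1, abs_mul, abs_of_pos hl]
      _ ≤ ∑ k, |M j k * d k| := Finset.abs_sum_le_sum_abs _ _
      _ = ∑ k, M j k * |d k| :=
        Finset.sum_congr rfl fun k _ => by rw [abs_mul, abs_of_nonneg (hM j k)]
  have hpow : ∀ t : ℕ, (l ^ t • fun j => |d j|) ≤ M ^ t *ᵥ fun j => |d j| := by
    intro t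
    induction t with
    | zero => simp
    | succ t ih =>
      calc (l ^ (t + 1) • fun j => |d j|) = l ^ t • (l • fun j => |d j|) := by
            rw [smul_smul, pow_succ]
        _ ≤ l ^ t • (M *ᵥ fun j => |d j|) :=
            smul_le_smul_of_nonneg_left hstep (pow_nonneg hl.le t)
        _ = M *ᵥ (l ^ t • fun j => |d j|) := (Matrix.mulVec_smul _ _ _).symm
        _ ≤ M *ᵥ (M ^ t *ᵥ fun j => |d j|) := hmono _ _ ih
        _ = M ^ (t + 1) *ᵥ fun j => |d j| := by rw [Matrix.mulVec_mulVec, pow_succ']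
  have hge : ∀ j, |d j| ≤ p j := by
    intro j
    refine ge_of_tendsto' (tendsto_pi_nhds.1 hp j) fun t => ?_
    have := hpow t j
    simp only [Pi.smul_apply, smul_eq_mul] at this ⊢
    rw [inv_pow, inv_mul_eq_div, le_div_iff₀ (pow_pos hl t), mul_comm]
    exact this
  have hppos : ∀ j, 0 < p j := by
    refine (eq_zero_or_pos_of_mulVec_eq_smul hM hirr
      (fun j => (abs_nonneg _).trans (hge j)) hMp).resolve_left fun h0 => hd ?_
    ext j
    have := hge j
    rw [h0] at this
    exact abs_nonpos_iff.1 this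
  obtain ⟨i₁, hi₁⟩ := Function.ne_iff.1 hd
  obtain ⟨i, -, hi⟩ :=
    Finset.exists_max_image Finset.univ (fun j => d j / p j) ⟨i₁, Finset.mem_univ _⟩
  have hzero : (d i / p i) • p - d = 0 := by
    refine (eq_zero_or_pos_of_mulVec_eq_smul hM hirr (l := l) (fun j => ?_) ?_).resolve_right
      fun hpos => ?_
    · have := hi j (Finset.mem_univ j)
      rw [div_le_iff₀ (hppos j)] at this
      simpa using this
    · rw [Matrix.mulVec_sub, Matrix.mulVec_smul, hMp, hMd, smul_sub, smul_comm]
    · have := hpos i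
      simp [div_mul_cancel₀ _ (hppos i).ne'] at this
  have hdp : ∀ j, d j = d i / p i * p j := fun j => by
    have := congrFun hzero j
    simp only [Pi.sub_apply, Pi.smul_apply, smul_eq_mul, Pi.zero_apply] at this
    linarith
  rcases lt_trichotomy (d i / p i) 0 with h | h | h
  · right
    intro j
    rw [hdp j]
    exact mul_neg_of_neg_of_pos h (hppos j)
  · refine absurd ?_ hd
    ext j
    rw [hdp j, h, zero_mul]
    rfl
  · left
    intro j
    rw [hdp j]
    exact mul_pos h (hppos j)

/-! ### Sorting the limit -/

theorem sortsScores_iff_of_strictMono {a : ℕ} {v : Fin a → ℝ} {σ₀ : Equiv.Perm (Fin a)}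
    (hv : StrictMono (v ∘ σ₀)) (σ : Equiv.Perm (Fin a)) :
    SortsScores v σ ↔ σ = σ₀ ∨ ∀ i, σ i = σ₀ i.rev := by
  have key : ∀ τ : Equiv.Perm (Fin a), Monotone (fun i => v (τ i)) → τ = σ₀ := by
    intro τ hτ
    have hmono : Monotone (σ₀⁻¹ * τ : Equiv.Perm (Fin a)) := by
      intro i j hij
      rw [← hv.le_iff_le]
      simpa using hτ hij
    have h1 : (hmono.strictMono_of_injective (Equiv.injective _)).orderIsoOfSurjective _
        (Equiv.surjective _) = OrderIso.refl _ := Subsingleton.elim _ _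
    have h2 : σ₀⁻¹ * τ = 1 := Equiv.ext fun i => by
      have := congrArg (fun e => e i) h1
      simpa using this
    rwa [inv_mul_eq_one, eq_comm] at h2
  constructor
  · rintro (h | h)
    · exact Or.inl (key σ h)
    · right
      have := key (Fin.revPerm.trans σ) fun i j hij => h (Fin.rev_le_rev.2 hij)
      intro i
      rw [← this]
      simp
  · rintro (rfl | h)
    · exact Or.inl hv.monotone
    · right
      intro i j hij
      simp only [h]
      exact hv.monotone (Fin.rev_le_rev.2 hij)

theorem sortsScores_neg_iff {a : ℕ} (v : Fin a → ℝ) (σ : Equiv.Perm (Fin a)) :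
    SortsScores (-v) σ ↔ SortsScores v σ := by
  simp only [SortsScores, Pi.neg_apply]
  rw [or_comm]
  refine or_congr ⟨fun h i j hij => ?_, fun h i j hij => ?_⟩
    ⟨fun h i j hij => ?_, fun h i j hij => ?_⟩ <;> have := h hij <;> simp_all

theorem IsC1POrdering.rev {a b : ℕ} {A : Matrix (Fin a) (Fin b) ℝ} {σ τ : Equiv.Perm (Fin a)}
    (h : IsC1POrdering A σ) (hτ : ∀ i, τ i = σ i.rev) : IsC1POrdering A τ := by
  refine ⟨fun i k => by simpa [hτ] using h.1 i.rev k, fun c i j k hij hjk hi hk => ?_⟩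
  simp only [Matrix.submatrix_apply, id, hτ] at hi hk ⊢
  exact h.2 c k.rev j.rev i.rev (Fin.rev_lt_rev.2 hjk) (Fin.rev_lt_rev.2 hij) hk hi

theorem isC1POrdering_iff {a b : ℕ} {A : Matrix (Fin a) (Fin b) ℝ}
    (huniq : C1POrderingUnique A) {σ₀ : Equiv.Perm (Fin a)} (h₀ : IsC1POrdering A σ₀)
    (σ : Equiv.Perm (Fin a)) : IsC1POrdering A σ ↔ σ = σ₀ ∨ ∀ i, σ i = σ₀ i.rev := by
  refine ⟨huniq σ₀ σ h₀, ?_⟩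
  rintro (rfl | h)
  · exact h₀
  · exact h₀.rev h

theorem C1POrderingUnique.submatrix {a b : ℕ} {A : Matrix (Fin a) (Fin b) ℝ}
    (huniq : C1POrderingUnique A) (σ₀ : Equiv.Perm (Fin a)) :
    C1POrderingUnique (A.submatrix σ₀ id) := by
  intro σ τ hσ hτ
  have h : ∀ ρ : Equiv.Perm (Fin a), IsC1POrdering (A.submatrix σ₀ id) ρ →
      IsC1POrdering A (σ₀ * ρ) := fun ρ hρ => by
    simpa [IsC1POrdering, Matrix.submatrix_submatrix] using hρ
  rcases huniq _ _ (h σ hσ) (h τ hτ) with h | h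
  · exact Or.inl (mul_left_cancel h)
  · exact Or.inr fun i => σ₀.injective (h i)

theorem gapMatrix_pow_mulVec {m b : ℕ} {A : Matrix (Fin (m + 1)) (Fin b) ℝ}
    (hU : ∀ c : ℝ, updateMatrix A *ᵥ (fun _ => c) = fun _ => c) (t : ℕ)
    (s : Fin (m + 1) → ℝ) :
    gapMatrix A ^ t *ᵥ (diffMatrix m *ᵥ s) = diffMatrix m *ᵥ (updateMatrix A ^ t *ᵥ s) := by
  induction t with
  | zero => simp
  | succ t ih =>
    rw [pow_succ', ← Matrix.mulVec_mulVec, ih, gapMatrix_mulVec_diffMatrix_mulVec hU,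
      pow_succ', Matrix.mulVec_mulVec _ (updateMatrix A)]

/-- The hypothesis on `l` holds in one ordering of the rows if and only if it does in any other, as
it compares all pairs of rows. In the C1P ordering `σ₀` it says that `l` is the growth rate of the
powers of the matrix of the gaps, which is nonnegative and irreducible. -/
theorem strictMono_or_strictAnti_of_mulVec_eq_smul {m b : ℕ}
    {C : Matrix (Fin (m + 1)) (Fin b) ℝ} {r : ℝ} (huniq : C1POrderingUnique C) (hr0 : 0 < r)
    (hr : ∀ i, ∑ h, C i h = r) {σ₀ : Equiv.Perm (Fin (m + 1))} (h₀ : IsC1POrdering C σ₀) {l : ℝ}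
    (hl : 0 < l)
    (hlim : ∀ x : Fin (m + 1) → ℝ, ∃ q : Fin (m + 1) → ℝ, updateMatrix C *ᵥ q = l • q ∧
      ∀ i j, Tendsto (fun t : ℕ => l⁻¹ ^ t * ((updateMatrix C ^ t *ᵥ x) i -
        (updateMatrix C ^ t *ᵥ x) j)) atTop (𝓝 (q i - q j)))
    {v : Fin (m + 1) → ℝ} (hv : diffMatrix m *ᵥ v ≠ 0) (hUv : updateMatrix C *ᵥ v = l • v) :
    StrictMono (v ∘ σ₀) ∨ StrictAnti (v ∘ σ₀) := by
  set A := C.submatrix σ₀ id with hAdef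
  have hA : IsPMatrix A := h₀
  have hrA : ∀ i, ∑ h, A i h = r := fun i => hr (σ₀ i)
  have hUA : ∀ c : ℝ, updateMatrix A *ᵥ (fun _ => c) = fun _ => c :=
    updateMatrix_mulVec_const hA.nonneg hr0 hrA
  have hAU : updateMatrix A = (updateMatrix C).submatrix σ₀ σ₀ := updateMatrix_submatrix C σ₀
  have heig : ∀ q, updateMatrix C *ᵥ q = l • q →
      gapMatrix A *ᵥ (diffMatrix m *ᵥ (q ∘ σ₀)) = l • (diffMatrix m *ᵥ (q ∘ σ₀)) := by
    intro q hq
    have h1 := submatrix_perm_pow_mulVec (updateMatrix C) σ₀ 1 q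
    rw [pow_one, pow_one, hq, ← hAU] at h1
    rw [gapMatrix_mulVec_diffMatrix_mulVec hUA, h1, ← Matrix.mulVec_smul]
    rfl
  have hd : diffMatrix m *ᵥ (v ∘ σ₀) ≠ 0 := by
    intro h0
    have hconst : ∀ i, v (σ₀ i) = v (σ₀ 0) := fun i => by
      have := cumMatrix_mulVec_diffMatrix_mulVec (v ∘ σ₀) i
      rw [h0, Matrix.mulVec_zero] at this
      exact (sub_eq_zero.1 this.symm)
    apply hv
    ext j
    have h1 := hconst (σ₀.symm j.succ)
    have h2 := hconst (σ₀.symm j.castSucc)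
    rw [Equiv.apply_symm_apply] at h1 h2
    simp [diffMatrix_mulVec, h1, h2]
  have hlimA : ∀ x : Fin m → ℝ, ∃ p : Fin m → ℝ, gapMatrix A *ᵥ p = l • p ∧
      Tendsto (fun t : ℕ => l⁻¹ ^ t • (gapMatrix A ^ t *ᵥ x)) atTop (𝓝 p) := by
    intro x
    obtain ⟨q, hq, hqlim⟩ := hlim ((cumMatrix m *ᵥ x) ∘ σ₀.symm)
    refine ⟨_, heig q hq, tendsto_pi_nhds.2 fun j => ?_⟩
    have h1 : ∀ t, gapMatrix A ^ t *ᵥ x = diffMatrix m *ᵥ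
        ((updateMatrix C ^ t *ᵥ ((cumMatrix m *ᵥ x) ∘ σ₀.symm)) ∘ σ₀) := by
      intro t
      rw [← submatrix_perm_pow_mulVec, ← hAU, ← gapMatrix_pow_mulVec hUA]
      congr 1
      rw [Function.comp_assoc, Equiv.symm_comp_self, Function.comp_id,
        diffMatrix_mulVec_cumMatrix_mulVec]
    simp only [h1, Pi.smul_apply, diffMatrix_mulVec, smul_eq_mul]
    exact hqlim _ _
  rcases pos_or_neg_of_mulVec_eq_smul (hA.gapMatrix_nonneg hr0 hrA)
    (fun K hne hK => hA.eq_univ_of_closed (huniq.submatrix σ₀) hr0 hrA hne hK) hl hlimA hd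
    (heig v hUv) with h | h
  · left
    refine Fin.strictMono_iff_lt_succ.2 fun j => ?_
    simpa [diffMatrix_mulVec] using h j
  · right
    refine Fin.strictAnti_iff_succ_lt.2 fun j => ?_
    simpa [diffMatrix_mulVec] using h j

theorem eventually_strictMono {a : ℕ} {u : ℕ → Fin (a + 1) → ℝ} {v : Fin (a + 1) → ℝ}
    (h : Tendsto u atTop (𝓝 v)) {σ : Fin (a + 1) → Fin (a + 1)} (hv : StrictMono (v ∘ σ)) :
    ∀ᶠ t in atTop, StrictMono (u t ∘ σ) := by
  simp only [Fin.strictMono_iff_lt_succ] at hv ⊢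
  exact eventually_all.2 fun j => (tendsto_pi_nhds.1 h _).eventually_lt
    (tendsto_pi_nhds.1 h _) (hv j)

/-- With at most two rows, every permutation sorts all scores. -/
theorem sortsScores_of_le_two {a : ℕ} (ha : a ≤ 2) (v : Fin a → ℝ) (σ : Equiv.Perm (Fin a)) :
    SortsScores v σ := by
  interval_cases a
  · exact Or.inl fun i => i.elim0
  · exact Or.inl fun i j _ => by rw [Subsingleton.elim i j]
  · rcases le_total (v (σ 0)) (v (σ 1)) with h | h
    · left; intro i j hij; fin_cases i <;> fin_cases j <;> simp_all
    · right; intro i j hij; fin_cases i <;> fin_cases j <;> simp_all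

theorem isC1POrdering_of_le_two {a b : ℕ} (ha : a ≤ 2) {A : Matrix (Fin a) (Fin b) ℝ}
    (hA : ∀ i h, A i h = 0 ∨ A i h = 1) (σ : Equiv.Perm (Fin a)) : IsC1POrdering A σ :=
  ⟨fun i h => hA (σ i) h, fun _ i j k hij hjk => by
    have := k.isLt
    simp only [Fin.lt_def] at hij hjk
    omega⟩

theorem IsPrePMatrix.binary {a b : ℕ} {A : Matrix (Fin a) (Fin b) ℝ} (hA : IsPrePMatrix A)
    (i : Fin a) (h : Fin b) : A i h = 0 ∨ A i h = 1 := by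
  obtain ⟨σ, hσ⟩ := hA
  simpa using hσ.1 (σ.symm i) h

/-- `W` is the kernel of the projection to the dominant eigenspace, up to constant vectors. If the
dominant eigenvalue vanishes, the matrix of the gaps is zero, so there are at most two rows. -/
theorem exists_submodule_tendsto_diffs {m b : ℕ} {C : Matrix (Fin (m + 1)) (Fin b) ℝ} {r : ℝ}
    (hC : IsPrePMatrix C) (huniq : C1POrderingUnique C) (hr0 : 0 < r)
    (hr : ∀ i, ∑ h, C i h = r) :
    ∃ W : Submodule ℝ (Fin (m + 1) → ℝ), W ≠ ⊤ ∧ ∀ s₀ : Fin (m + 1) → ℝ, s₀ ∉ W →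
      ∃ d : Fin m → ℝ, Tendsto (diffs C s₀) atTop (𝓝 d) ∧
        (1 < m → ∃ σ₀ : Equiv.Perm (Fin (m + 1)), IsC1POrdering C σ₀ ∧
          (StrictMono ((cumMatrix m *ᵥ d) ∘ σ₀) ∨ StrictAnti ((cumMatrix m *ᵥ d) ∘ σ₀))) := by
  have hC0 : ∀ i h, 0 ≤ C i h := fun i h => by rcases hC.binary i h with h | h <;> simp [h]
  have hU := updateMatrix_mulVec_const hC0 hr0 hr
  rcases Nat.eq_zero_or_pos m with rfl | hm
  · refine ⟨⊥, bot_ne_top, fun s₀ _ => ⟨0, ?_, fun h => absurd h (by simp)⟩⟩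
    exact tendsto_const_nhds.congr fun t => Subsingleton.elim _ _
  have hS : diffMatrix m ≠ 0 := by
    intro h0
    have := diffMatrix_mulVec_cumMatrix_mulVec fun _ : Fin m => (1 : ℝ)
    rw [h0, Matrix.zero_mulVec] at this
    exact zero_ne_one (congrFun this ⟨0, hm⟩)
  obtain ⟨l, hl0, π, hπ, ⟨s₁, hs₁⟩, hlim, hzero⟩ :=
    exists_dominant_projection (updateMatrix_posSemidef hC0 hr0 hr) hS
  refine ⟨LinearMap.ker ((diffMatrix m).mulVecLin ∘ₗ π), fun h => hs₁ ?_, fun s₀ hs₀ => ?_⟩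
  · have : s₁ ∈ LinearMap.ker ((diffMatrix m).mulVecLin ∘ₗ π) := h ▸ Submodule.mem_top
    simpa using this
  have hs₀' : diffMatrix m *ᵥ π s₀ ≠ 0 := fun h => hs₀ (by simpa using h)
  rcases hl0.eq_or_lt with rfl | hl
  · -- all differences vanish after one pass
    refine ⟨0, ?_, fun hm1 => ?_⟩
    · rw [← tendsto_add_atTop_iff_nat 1]
      refine tendsto_const_nhds.congr fun t => ?_
      rw [diffs_succ_eq hU, pow_succ', ← Matrix.mulVec_mulVec, hzero rfl, normalize_zero]
    · obtain ⟨σ₀, h₀⟩ := hC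
      have hA : IsPMatrix (C.submatrix σ₀ id) := h₀
      have hrA : ∀ i, ∑ h, C.submatrix σ₀ id i h = r := fun i => hr (σ₀ i)
      -- each column of `updateMatrix C` is constant, so the matrix of the gaps is zero, and any
      -- set of gaps is closed
      have hcol : ∀ s : Fin (m + 1) → ℝ, ∀ i,
          (updateMatrix C *ᵥ s) i = (updateMatrix C *ᵥ s) 0 := by
        intro s i
        have := cumMatrix_mulVec_diffMatrix_mulVec (updateMatrix C *ᵥ s) i
        rw [hzero rfl, Matrix.mulVec_zero] at this
        exact sub_eq_zero.1 this.symm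
      have hgap : ∀ j k, gapMatrix (C.submatrix σ₀ id) j k = 0 := by
        have h1 : ∀ x, gapMatrix (C.submatrix σ₀ id) *ᵥ x = 0 := by
          intro x
          rw [gapMatrix, ← Matrix.mulVec_mulVec, ← Matrix.mulVec_mulVec, updateMatrix_submatrix]
          have h2 := submatrix_perm_pow_mulVec (updateMatrix C) σ₀ 1
            ((cumMatrix m *ᵥ x) ∘ σ₀.symm)
          rw [pow_one, pow_one, Function.comp_assoc, Equiv.symm_comp_self, Function.comp_id] at h2
          rw [h2]
          ext j
          rw [diffMatrix_mulVec, Function.comp, Function.comp, hcol _ (σ₀ j.succ),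
            hcol _ (σ₀ j.castSucc), sub_self]
          rfl
        intro j k
        have := congrFun (h1 (Pi.single k 1)) j
        simpa using this
      have huniv := hA.eq_univ_of_closed (huniq.submatrix σ₀) hr0 hrA
        (Set.singleton_nonempty (⟨0, hm⟩ : Fin m)) fun j _ k _ => hgap j k
      have : (⟨1, hm1⟩ : Fin m) ∈ ({⟨0, hm⟩} : Set (Fin m)) := huniv ▸ Set.mem_univ _
      simp at this
  · refine ⟨normalize (diffMatrix m *ᵥ π s₀), ?_, fun _ => ?_⟩
    · rw [← tendsto_add_atTop_iff_nat 1]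
      refine (((tendsto_normalize hs₀').comp (hlim hl s₀)).comp (tendsto_add_atTop_nat 1)).congr
        fun t => ?_
      simp only [Function.comp]
      rw [diffs_succ_eq hU, normalize_smul (pow_pos (inv_pos.2 hl) _)]
    · obtain ⟨σ₀, h₀⟩ := hC
      refine ⟨σ₀, h₀, ?_⟩
      -- the difference of two scores is a difference of partial sums of `S *ᵥ (U ^ t *ᵥ x)`
      have hpair : ∀ x : Fin (m + 1) → ℝ, ∃ q : Fin (m + 1) → ℝ, updateMatrix C *ᵥ q = l • q ∧
          ∀ i j, Tendsto (fun t : ℕ => l⁻¹ ^ t * ((updateMatrix C ^ t *ᵥ x) i -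
            (updateMatrix C ^ t *ᵥ x) j)) atTop (𝓝 (q i - q j)) := by
        refine fun x => ⟨π x, hπ x, fun i j => ?_⟩
        have hc : Continuous fun d : Fin m → ℝ => (cumMatrix m *ᵥ d) i - (cumMatrix m *ᵥ d) j := by
          simp only [Matrix.mulVec, dotProduct]
          fun_prop
        have h := (hc.tendsto _).comp (hlim hl x)
        simp only [Function.comp_def, cumMatrix_mulVec_diffMatrix_mulVec, Matrix.mulVec_smul,
          Pi.smul_apply, smul_eq_mul, ← mul_sub, sub_sub_sub_cancel_right] at h
        exact h
      obtain ⟨c, hc, hn⟩ := exists_normalize_eq_smul (diffMatrix m *ᵥ π s₀)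
      have hval : ∀ i, (cumMatrix m *ᵥ normalize (diffMatrix m *ᵥ π s₀)) i =
          c * (π s₀ i - π s₀ 0) := by
        intro i
        rw [hn, Matrix.mulVec_smul, Pi.smul_apply, cumMatrix_mulVec_diffMatrix_mulVec,
          smul_eq_mul]
      refine (strictMono_or_strictAnti_of_mulVec_eq_smul huniq hr0 hr h₀ hl hpair hs₀'
        (hπ s₀)).imp (fun h i j hij => ?_) (fun h i j hij => ?_) <;>
      · simp only [Function.comp, hval]
        exact mul_lt_mul_of_pos_left (sub_lt_sub_right (h hij) _) hc

/-- The limit scores have the strict order of the rows, and strict inequalities persist nearby, so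
also the scores after finitely many passes sort the rows correctly. -/
theorem exists_submodule_reconstruction {m b : ℕ} {C : Matrix (Fin (m + 1)) (Fin b) ℝ} {r : ℝ}
    (hC : IsPrePMatrix C) (huniq : C1POrderingUnique C) (hr0 : 0 < r)
    (hr : ∀ i, ∑ h, C i h = r) :
    ∃ W : Submodule ℝ (Fin (m + 1) → ℝ), W ≠ ⊤ ∧ ∀ s₀ : Fin (m + 1) → ℝ, s₀ ∉ W →
      (∃ d : Fin m → ℝ, Tendsto (diffs C s₀) atTop (𝓝 d) ∧
        ∀ σ : Equiv.Perm (Fin (m + 1)), SortsScores (cumMatrix m *ᵥ d) σ ↔ IsC1POrdering C σ) ∧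
      ∃ t₀ : ℕ, ∀ t ≥ t₀, ∀ σ : Equiv.Perm (Fin (m + 1)),
        SortsScores (scores C s₀ t) σ ↔ IsC1POrdering C σ := by
  obtain ⟨W, hW, h⟩ := exists_submodule_tendsto_diffs hC huniq hr0 hr
  refine ⟨W, hW, fun s₀ hs₀ => ?_⟩
  obtain ⟨d, hd, hsort⟩ := h s₀ hs₀
  rcases le_or_gt m 1 with hm | hm
  · have hall : ∀ (v : Fin (m + 1) → ℝ) σ, SortsScores v σ ↔ IsC1POrdering C σ := fun v σ =>
      iff_of_true (sortsScores_of_le_two (by omega) v σ)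
        (isC1POrdering_of_le_two (by omega) hC.binary σ)
    exact ⟨⟨d, hd, hall _⟩, 0, fun t _ => hall _⟩
  obtain ⟨σ₀, h₀, hstrict⟩ := hsort hm
  have hc : Continuous fun d : Fin m → ℝ => cumMatrix m *ᵥ d :=
    Continuous.matrix_mulVec continuous_const continuous_id
  have hlim : Tendsto (scores C s₀) atTop (𝓝 (cumMatrix m *ᵥ d)) := (hc.tendsto d).comp hd
  have hmono : ∀ v : Fin (m + 1) → ℝ, StrictMono (v ∘ σ₀) → ∀ σ,
      SortsScores v σ ↔ IsC1POrdering C σ := fun v hv σ =>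
    (sortsScores_iff_of_strictMono hv σ).trans (isC1POrdering_iff huniq h₀ σ).symm
  have hanti : ∀ v : Fin (m + 1) → ℝ, StrictMono ((-v) ∘ σ₀) → ∀ σ,
      SortsScores v σ ↔ IsC1POrdering C σ := fun v hv σ =>
    (sortsScores_neg_iff v σ).symm.trans (hmono _ hv σ)
  rcases hstrict with hs | hs
  · exact ⟨⟨d, hd, hmono _ hs⟩, eventually_atTop.1
      ((eventually_strictMono hlim hs).mono fun t ht => hmono _ ht)⟩
  · have hs' : StrictMono ((-(cumMatrix m *ᵥ d)) ∘ σ₀) := fun i j hij => neg_lt_neg (hs hij)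
    exact ⟨⟨d, hd, hanti _ hs'⟩, eventually_atTop.1
      ((eventually_strictMono hlim.neg hs').mono fun t ht => hanti _ ht)⟩

/-! ### Correctness and step count of the loops -/

/-- The invariant rule for a loop whose body is one assignment to the array `a`: the body does not
affect the index arrays and the other arrays, so the invariant `P` is about the array `a` alone. -/
theorem run_loop_store (a : RealArr) (ix : IExp) (e : RExp) (n : IExp) (μ : Mem)
    (P : ℕ → (ℕ → ℝ) → Prop) (h0 : P 0 (μ.real a))
    (hs : ∀ i < n.eval μ, ∀ ν : Mem, ν.idx = μ.idx → ν.var 0 = i →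
      (∀ b ≠ a, ν.real b = μ.real b) → P i (ν.real a) →
      P (i + 1) (Function.update (ν.real a) (ix.eval ν) (e.eval ν))) :
    ((Cmd.loop 0 n (.store a ix e)).run μ).1.idx = μ.idx ∧
      (∀ b ≠ a, ((Cmd.loop 0 n (.store a ix e)).run μ).1.real b = μ.real b) ∧
      P (n.eval μ) (((Cmd.loop 0 n (.store a ix e)).run μ).1.real a) ∧
      ((Cmd.loop 0 n (.store a ix e)).run μ).2 =
        n.cost + 1 + n.eval μ * (ix.cost + e.cost + 2) := by
  simp only [Cmd.run]
  generalize n.eval μ = N at hs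
  induction N with
  | zero => simpa using h0
  | succ k ih =>
    obtain ⟨h1, h2, h3, h4⟩ := ih fun i hi => hs i (by omega)
    rw [List.range_succ, List.foldl_append]
    simp only [List.foldl_cons, List.foldl_nil]
    generalize List.foldl _ _ (List.range k) = ξ at h1 h2 h3 h4 ⊢
    refine ⟨h1, fun b hb => ?_, ?_, ?_⟩
    · simp [Function.update_of_ne hb, h2 b hb]
    · have := hs k (by omega) { ξ.1 with var := Function.update ξ.1.var 0 k } h1 (by simp) h2 h3
      simpa using this
    · rw [h4]; ring

theorem run_seq (p q : Cmd) (μ : Mem) : (Cmd.seq p q).run μ =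
    ((q.run (p.run μ).1).1, (p.run μ).2 + (q.run (p.run μ).1).2) := rfl

theorem run_progCumSum (μ : Mem) :
    (progCumSum.run μ).1.idx = μ.idx ∧
      (∀ b ≠ RealArr.score, (progCumSum.run μ).1.real b = μ.real b) ∧
      (∀ k ≤ μ.idx .size 0,
        (progCumSum.run μ).1.real .score k = ∑ j ∈ Finset.range k, μ.real .diff j) ∧
      (progCumSum.run μ).2 = 6 + 9 * μ.idx .size 0 := by
  obtain ⟨h1, h2, h3, h4⟩ := run_loop_store .score (.succ ctr)
    (.add (.load .score ctr) (.load .diff ctr)) (.load .size (.lit 0))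
    ((Cmd.store .score (.lit 0) .zero).run μ).1
    (fun i y => ∀ k ≤ i, y k = ∑ j ∈ Finset.range k, μ.real .diff j)
    (fun k hk => by obtain rfl : k = 0 := by omega
                    simp [Cmd.run, IExp.eval, RExp.eval])
    (fun i _ ν _ hv hb hP k hk => by
      have hd : ν.real .diff = μ.real .diff := by
        rw [hb _ (by decide)]; simp [Cmd.run]
      rcases hk.eq_or_lt with rfl | hlt
      · simp [IExp.eval, RExp.eval, ctr, hv, hd, hP i le_rfl, Finset.sum_range_succ]
      · have hne : k ≠ i + 1 := hlt.ne
        simp [IExp.eval, ctr, hv, hne, hP k (by omega)])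
  refine ⟨h1, fun b hb => (h2 b hb).trans (by simp [Cmd.run, hb]), h3, ?_⟩
  refine (congrArg (3 + ·) h4).trans ?_
  simp [IExp.eval, IExp.cost, RExp.cost, ctr, Cmd.run]
  ring

theorem run_resetWeights (μ : Mem) :
    ((forEntries (.store .weight (.load .col ctr) .zero)).run μ).1.idx = μ.idx ∧
      (∀ b ≠ RealArr.weight,
        ((forEntries (.store .weight (.load .col ctr) .zero)).run μ).1.real b = μ.real b) ∧
      (∀ p < μ.idx .size 1, ((forEntries (.store .weight (.load .col ctr) .zero)).run μ).1.real
        .weight (μ.idx .col p) = 0) ∧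
      ((forEntries (.store .weight (.load .col ctr) .zero)).run μ).2 =
        3 + 5 * μ.idx .size 1 := by
  obtain ⟨h1, h2, h3, h4⟩ := run_loop_store .weight (.load .col ctr) .zero
    (.load .size (.lit 1)) μ (fun i y => ∀ p < i, y (μ.idx .col p) = 0) (by simp)
    (fun i _ ν hi hv _ hP p hp => by
      simp only [IExp.eval, RExp.eval, ctr, hv, hi, Function.update_apply]
      split_ifs with h
      · rfl
      · exact hP p (lt_of_le_of_ne (Nat.lt_succ_iff.1 hp) fun he => h (he ▸ rfl)))
  refine ⟨h1, h2, h3, h4.trans ?_⟩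
  simp [IExp.eval, IExp.cost, RExp.cost, ctr]
  ring

theorem run_resetScores (μ : Mem) :
    ((forUsers (.store .next ctr .zero)).run μ).1.idx = μ.idx ∧
      (∀ b ≠ RealArr.next,
        ((forUsers (.store .next ctr .zero)).run μ).1.real b = μ.real b) ∧
      (∀ k < μ.idx .size 0 + 1,
        ((forUsers (.store .next ctr .zero)).run μ).1.real .next k = 0) ∧
      ((forUsers (.store .next ctr .zero)).run μ).2 = 8 + 4 * μ.idx .size 0 := by
  obtain ⟨h1, h2, h3, h4⟩ := run_loop_store .next ctr .zero
    (.succ (.load .size (.lit 0))) μ (fun i y => ∀ k < i, y k = 0) (by simp)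
    (fun i _ ν hi hv _ hP p hp => by
      simp only [IExp.eval, RExp.eval, ctr, hv, Function.update_apply]
      split_ifs with h
      · rfl
      · exact hP p (lt_of_le_of_ne (Nat.lt_succ_iff.1 hp) h))
  refine ⟨h1, h2, h3, h4.trans ?_⟩
  simp [IExp.eval, IExp.cost, RExp.cost, ctr]
  ring

theorem run_progMulAdd {y vals x : RealArr} (hv : vals ≠ y) (hx : x ≠ y) (out inp : IdxArr)
    (μ : Mem) :
    ((progMulAdd y out vals x inp).run μ).1.idx = μ.idx ∧
      (∀ b ≠ y, ((progMulAdd y out vals x inp).run μ).1.real b = μ.real b) ∧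
      (∀ k, μ.real y k = 0 → ((progMulAdd y out vals x inp).run μ).1.real y k =
        ∑ p ∈ Finset.range (μ.idx .size 1),
          if μ.idx out p = k then μ.real vals p * μ.real x (μ.idx inp p) else 0) ∧
      ((progMulAdd y out vals x inp).run μ).2 = 3 + 14 * μ.idx .size 1 := by
  obtain ⟨h1, h2, h3, h4⟩ := run_loop_store y (.load out ctr)
    (.add (.load y (.load out ctr)) (.mul (.load vals ctr) (.load x (.load inp ctr))))
    (.load .size (.lit 1)) μ
    (fun i arr => ∀ k, μ.real y k = 0 → arr k = ∑ p ∈ Finset.range i,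
      if μ.idx out p = k then μ.real vals p * μ.real x (μ.idx inp p) else 0)
    (fun k hk => by simpa using hk)
    (fun i _ ν hi hc hb hP k hk => by
      rw [Finset.sum_range_succ, ← hP k hk]
      simp only [IExp.eval, RExp.eval, ctr, hc, hi, hb _ hv, hb _ hx, Function.update_apply]
      by_cases h : k = μ.idx out i
      · simp [h]
      · simp [h, Ne.symm h])
  refine ⟨h1, h2, h3, h4.trans ?_⟩
  simp [IExp.eval, IExp.cost, RExp.cost, ctr]
  ring

theorem run_progDiff (μ : Mem) :
    (progDiff.run μ).1.idx = μ.idx ∧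
      (∀ b ≠ RealArr.diff, (progDiff.run μ).1.real b = μ.real b) ∧
      (∀ k < μ.idx .size 0,
        (progDiff.run μ).1.real .diff k = μ.real .next (k + 1) - μ.real .next k) ∧
      (progDiff.run μ).2 = 3 + 9 * μ.idx .size 0 := by
  obtain ⟨h1, h2, h3, h4⟩ := run_loop_store .diff ctr
    (.sub (.load .next (.succ ctr)) (.load .next ctr)) (.load .size (.lit 0)) μ
    (fun i y => ∀ k < i, y k = μ.real .next (k + 1) - μ.real .next k) (by simp)
    (fun i _ ν hi hv hb hP p hp => by
      simp only [IExp.eval, RExp.eval, ctr, hv, hb _ (show RealArr.next ≠ .diff by decide),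
        Function.update_apply]
      split_ifs with h
      · rw [h]
      · exact hP p (lt_of_le_of_ne (Nat.lt_succ_iff.1 hp) h))
  refine ⟨h1, h2, h3, h4.trans ?_⟩
  simp [IExp.eval, IExp.cost, RExp.cost, ctr]
  ring

theorem run_progNormalize (μ : Mem) :
    (progNormalize.run μ).1.idx = μ.idx ∧
      (∀ b, b ≠ RealArr.diff → b ≠ RealArr.norm →
        (progNormalize.run μ).1.real b = μ.real b) ∧
      (∀ k < μ.idx .size 0, (progNormalize.run μ).1.real .diff k = μ.real .diff k /
        Real.sqrt (∑ j ∈ Finset.range (μ.idx .size 0), μ.real .diff j * μ.real .diff j)) ∧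
      (progNormalize.run μ).2 = 14 + 19 * μ.idx .size 0 := by
  obtain ⟨h1, h2, h3, h4⟩ := run_loop_store .norm (.lit 0)
    (.add (.load .norm (.lit 0)) (.mul (.load .diff ctr) (.load .diff ctr)))
    (.load .size (.lit 0)) ((Cmd.store .norm (.lit 0) .zero).run μ).1
    (fun i y => y 0 = ∑ j ∈ Finset.range i, μ.real .diff j * μ.real .diff j)
    (by simp [Cmd.run, IExp.eval, RExp.eval])
    (fun i _ ν _ hv hb hP => by
      have hd : ν.real .diff = μ.real .diff := by
        rw [hb _ (by decide)]; simp [Cmd.run]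
      simp [IExp.eval, RExp.eval, ctr, hv, hd, hP, Finset.sum_range_succ])
  set ν₁ := ((Cmd.store .norm (.lit 0) .zero).run μ).1 with hν₁
  have hidx₁ : ν₁.idx = μ.idx := rfl
  have hreal₁ : ∀ b ≠ RealArr.norm, ν₁.real b = μ.real b := fun b hb => by simp [hν₁, Cmd.run, hb]
  set L := (Cmd.loop 0 (.load .size (.lit 0)) (.store .norm (.lit 0)
    (.add (.load .norm (.lit 0)) (.mul (.load .diff ctr) (.load .diff ctr))))).run ν₁ with hL
  set ν₂ := ((Cmd.store .norm (.lit 0) (.sqrt (.load .norm (.lit 0)))).run L.1).1 with hν₂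
  have hidx₂ : ν₂.idx = μ.idx := h1
  have hreal₂ : ∀ b ≠ RealArr.norm, ν₂.real b = μ.real b := fun b hb => by
    rw [← hreal₁ b hb, ← h2 b hb]; simp [hν₂, Cmd.run, hb]
  have hnorm : ν₂.real .norm 0 = Real.sqrt
      (∑ j ∈ Finset.range (μ.idx .size 0), μ.real .diff j * μ.real .diff j) := by
    have : ν₂.real .norm 0 = Real.sqrt (L.1.real .norm 0) := by
      simp [hν₂, Cmd.run, IExp.eval, RExp.eval]
    rw [this, h3]
    simp [IExp.eval, hidx₁]
  obtain ⟨k1, k2, k3, k4⟩ := run_loop_store .diff ctr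
    (.div (.load .diff ctr) (.load .norm (.lit 0))) (.load .size (.lit 0)) ν₂
    (fun i y => (∀ k < i, y k = ν₂.real .diff k / ν₂.real .norm 0) ∧
      ∀ k, i ≤ k → y k = ν₂.real .diff k) (by simp)
    (fun i _ ν hi hv hb hP => by
      simp only [IExp.eval, RExp.eval, ctr, hv, hb _ (show RealArr.norm ≠ .diff by decide),
        Function.update_apply]
      refine ⟨fun k hk => ?_, fun k hk => ?_⟩
      · split_ifs with h
        · rw [h, hP.2 i le_rfl]
        · exact hP.1 k (lt_of_le_of_ne (Nat.lt_succ_iff.1 hk) h)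
      · rw [if_neg (by omega), hP.2 k (by omega)])
  refine ⟨k1.trans hidx₂, fun b hb hb' => (k2 b hb).trans (hreal₂ b hb'), fun k hk => ?_, ?_⟩
  · have := k3.1 k (by simpa [IExp.eval, hidx₂] using hk)
    rw [hnorm, hreal₂ _ (by decide)] at this
    exact this
  · refine (congrArg₂ (fun x y => 3 + (x + (5 + y))) h4 k4).trans ?_
    simp [IExp.eval, IExp.cost, RExp.cost, ctr, hidx₁, hidx₂]
    ring

/-! ### Sparse products and the two programs -/

theorem StoresSparse.congr {a b : ℕ} {μ ν : Mem} {vals : RealArr}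
    {A : Matrix (Fin a) (Fin b) ℝ} (h : StoresSparse μ vals A) (hidx : ν.idx = μ.idx)
    (hval : ν.real vals = μ.real vals) : StoresSparse ν vals A := by
  unfold StoresSparse at h ⊢
  rw [hidx, hval]
  exact h

theorem StoresSparse.size_eq_nnz {a b : ℕ} {μ : Mem} {vals : RealArr}
    {A : Matrix (Fin a) (Fin b) ℝ} (h : StoresSparse μ vals A) : μ.idx .size 1 = nnz A := by
  obtain ⟨e, -⟩ := h
  have := Nat.card_congr e
  rw [Nat.card_fin] at this
  exact this

theorem StoresSparse.sum_eq {a b : ℕ} {μ : Mem} {vals : RealArr} {A : Matrix (Fin a) (Fin b) ℝ}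
    (h : StoresSparse μ vals A) (F : ℕ → ℕ → ℝ) :
    ∑ p ∈ Finset.range (μ.idx .size 1), μ.real vals p * F (μ.idx .row p) (μ.idx .col p) =
      ∑ i : Fin a, ∑ k : Fin b, A i k * F i k := by
  classical
  obtain ⟨e, he⟩ := h
  rw [Finset.sum_range, ← Fintype.sum_prod_type']
  let G : Fin a × Fin b → ℝ := fun q => A q.1 q.2 * F q.1 q.2
  have h1 : ∀ p : Fin (μ.idx .size 1),
      μ.real vals p * F (μ.idx .row p) (μ.idx .col p) = G (e p).1 := fun p => by
    obtain ⟨hr, hc, hv⟩ := he p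
    simp only [G, hr, hc, hv]
  refine (Finset.sum_congr rfl fun p _ => h1 p).trans
    ((Equiv.sum_comp e fun q => G q.1).trans ?_)
  refine (Finset.sum_subtype (Finset.univ.filter fun q : Fin a × Fin b => A q.1 q.2 ≠ 0)
    (by simp) G).symm.trans ?_
  exact Finset.sum_filter_of_ne fun q _ hq => left_ne_zero_of_mul hq

/-- The vector `x` needs to agree with `w` at the stored columns only. -/
theorem StoresSparse.sum_row_eq {a b : ℕ} {μ : Mem} {vals : RealArr}
    {A : Matrix (Fin a) (Fin b) ℝ} (h : StoresSparse μ vals A) (i : Fin a) {x : ℕ → ℝ}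
    {w : Fin b → ℝ} (hx : ∀ p < μ.idx .size 1, ∀ k : Fin b, μ.idx .col p = k → x k = w k) :
    ∑ p ∈ Finset.range (μ.idx .size 1),
      (if μ.idx .row p = i then μ.real vals p * x (μ.idx .col p) else 0) = (A *ᵥ w) i := by
  let w' : ℕ → ℝ := fun n => if hn : n < b then w ⟨n, hn⟩ else 0
  have h1 : ∀ p ∈ Finset.range (μ.idx .size 1),
      (if μ.idx .row p = i then μ.real vals p * x (μ.idx .col p) else 0) =
        μ.real vals p * (fun r c => if r = (i : ℕ) then w' c else 0)
          (μ.idx .row p) (μ.idx .col p) := by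
    intro p hp
    have hp := Finset.mem_range.1 hp
    obtain ⟨e, he⟩ := h
    have hc := (he ⟨p, hp⟩).2.1
    simp only at hc
    rw [hc, hx p hp _ hc]
    simp [w']
  rw [Finset.sum_congr rfl h1, h.sum_eq fun r c => if r = (i : ℕ) then w' c else 0]
  simp [Fin.val_inj, Matrix.mulVec, dotProduct, w']

theorem StoresSparse.sum_col_eq {a b : ℕ} {μ : Mem} {vals : RealArr}
    {A : Matrix (Fin a) (Fin b) ℝ} (h : StoresSparse μ vals A) (k : Fin b) {x : ℕ → ℝ}
    {s : Fin a → ℝ} (hx : ∀ i : Fin a, x i = s i) :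
    ∑ p ∈ Finset.range (μ.idx .size 1),
      (if μ.idx .col p = k then μ.real vals p * x (μ.idx .row p) else 0) = (Aᵀ *ᵥ s) k := by
  have h1 : ∀ p ∈ Finset.range (μ.idx .size 1),
      (if μ.idx .col p = k then μ.real vals p * x (μ.idx .row p) else 0) =
        μ.real vals p * (fun r c => if c = (k : ℕ) then x r else 0)
          (μ.idx .row p) (μ.idx .col p) := fun p _ => by simp
  rw [Finset.sum_congr rfl h1, h.sum_eq fun r c => if c = (k : ℕ) then x r else 0]
  simp [Fin.val_inj, Matrix.mulVec, dotProduct, hx]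

theorem StoresDiffs.cumSum {m : ℕ} {μ : Mem} {d : Fin m → ℝ} (h : StoresDiffs μ d)
    (i : Fin (m + 1)) : (progCumSum.run μ).1.real .score i = (cumMatrix m *ᵥ d) i := by
  rw [(run_progCumSum μ).2.2.1 i (by rw [h.1]; omega)]
  induction i using Fin.induction with
  | zero => simp [cumMatrix_mulVec_zero]
  | succ j ih =>
    rw [cumMatrix_mulVec_succ, ← ih, Fin.val_succ, Finset.sum_range_succ, h.2 j,
      Fin.val_castSucc]

/-- The last two phases, which both programs share. -/
theorem run_diff_normalize {m : ℕ} {μ : Mem} (hm : μ.idx .size 0 = m) {s : Fin (m + 1) → ℝ}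
    (hs : ∀ i : Fin (m + 1), μ.real .next i = s i) :
    ((Cmd.seq progDiff progNormalize).run μ).1.idx = μ.idx ∧
      (∀ b, b ≠ RealArr.diff → b ≠ RealArr.norm →
        ((Cmd.seq progDiff progNormalize).run μ).1.real b = μ.real b) ∧
      (∀ j : Fin m, ((Cmd.seq progDiff progNormalize).run μ).1.real .diff j =
        normalize (diffMatrix m *ᵥ s) j) ∧
      ((Cmd.seq progDiff progNormalize).run μ).2 = 17 + 28 * m := by
  obtain ⟨h1, h2, h3, h4⟩ := run_progDiff μ
  obtain ⟨k1, k2, k3, k4⟩ := run_progNormalize (progDiff.run μ).1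
  have hd : ∀ j : Fin m, (progDiff.run μ).1.real .diff j = (diffMatrix m *ᵥ s) j := by
    intro j
    rw [h3 j (by omega), diffMatrix_mulVec, ← hs, ← hs, Fin.val_succ, Fin.val_castSucc]
  refine ⟨k1.trans h1, fun b hb hb' => (k2 b hb hb').trans (h2 b hb), fun j => ?_, ?_⟩
  · refine (k3 j (by rw [h1]; omega)).trans ?_
    rw [h1, hm, Finset.sum_range, normalize]
    simp only [hd]
  · change _ + _ = _
    rw [h4, k4, h1, hm]
    ring

theorem run_progStep {m b : ℕ} {C : Matrix (Fin (m + 1)) (Fin b) ℝ} {μ : Mem} {d : Fin m → ℝ}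
    (h : Stores μ C d) :
    Stores (progStep.run μ).1 C (step C d) ∧
      (progStep.run μ).2 = 40 + 41 * m + 33 * μ.idx .size 1 := by
  obtain ⟨hd, hrow, hcol⟩ := h
  obtain ⟨a1, a2, -, a4⟩ := run_progCumSum μ
  have a3 := hd.cumSum
  rw [hd.1] at a4
  rw [progStep, run_seq, run_seq, run_seq, run_seq, run_seq]
  generalize progCumSum.run μ = ξ₁ at a1 a2 a3 a4 ⊢
  obtain ⟨b1, b2, b3, b4⟩ := run_resetWeights ξ₁.1
  generalize (forEntries (.store .weight (.load .col ctr) .zero)).run ξ₁.1 = ξ₂ at b1 b2 b3 b4 ⊢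
  obtain ⟨c1, c2, c3, c4⟩ := run_progMulAdd (y := .weight) (vals := .colVal) (x := .score)
    (by decide) (by decide) .col .row ξ₂.1
  generalize (progMulAdd .weight .col .colVal .score .row).run ξ₂.1 = ξ₃ at c1 c2 c3 c4 ⊢
  obtain ⟨d1, d2, d3, d4⟩ := run_resetScores ξ₃.1
  generalize (forUsers (.store .next ctr .zero)).run ξ₃.1 = ξ₄ at d1 d2 d3 d4 ⊢
  obtain ⟨e1, e2, e3, e4⟩ := run_progMulAdd (y := .next) (vals := .rowVal) (x := .weight)
    (by decide) (by decide) .row .col ξ₄.1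
  generalize (progMulAdd .next .row .rowVal .weight .col).run ξ₄.1 = ξ₅ at e1 e2 e3 e4 ⊢
  have i2 : ξ₂.1.idx = μ.idx := b1.trans a1
  have i3 : ξ₃.1.idx = μ.idx := c1.trans i2
  have i4 : ξ₄.1.idx = μ.idx := d1.trans i3
  have i5 : ξ₅.1.idx = μ.idx := e1.trans i4
  -- only the weights of the options in the list are computed; no entry refers to any other
  have hw : ∀ p < μ.idx .size 1, ∀ k : Fin b, μ.idx .col p = k →
      ξ₄.1.real .weight k = ((colNormalized C)ᵀ *ᵥ (cumMatrix m *ᵥ d)) k := by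
    intro p hp k hk
    have hz := b3 p (by rwa [a1])
    rw [a1, hk] at hz
    have hcol₂ := hcol.congr i2
      ((b2 _ (show RealArr.colVal ≠ .weight by decide)).trans (a2 _ (by decide)))
    rw [d2 _ (by decide), c3 _ hz]
    exact hcol₂.sum_col_eq k fun i => by rw [b2 _ (by decide), a3]
  have hrow₄ := hrow.congr i4 (((d2 .rowVal (by decide)).trans
    (c2 _ (by decide))).trans ((b2 _ (by decide)).trans (a2 _ (by decide))))
  have hnext : ∀ i : Fin (m + 1), ξ₅.1.real .next i =
      (rowNormalized C *ᵥ ((colNormalized C)ᵀ *ᵥ (cumMatrix m *ᵥ d))) i := by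
    intro i
    rw [e3 i (d3 i (by rw [i3, hd.1]; exact i.isLt))]
    refine hrow₄.sum_row_eq i fun p hp k hk => hw p ?_ k ?_
    · rwa [i4] at hp
    · rwa [i4] at hk
  obtain ⟨f1, f2, f3, f4⟩ := run_diff_normalize (by rw [i5, hd.1]) hnext
  have hreal : ∀ b, b ≠ RealArr.diff → b ≠ .norm → b ≠ .next → b ≠ .weight → b ≠ .score →
      ((Cmd.seq progDiff progNormalize).run ξ₅.1).1.real b = μ.real b := by
    intro b n1 n2 n3 n4 n5
    rw [f2 b n1 n2, e2 b n3, d2 b n3, c2 b n4, b2 b n4, a2 b n5]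
  have hidx := f1.trans i5
  refine ⟨⟨⟨by rw [hidx, hd.1], f3⟩, hrow.congr hidx (hreal _ ?_ ?_ ?_ ?_ ?_),
    hcol.congr hidx (hreal _ ?_ ?_ ?_ ?_ ?_)⟩, ?_⟩
  any_goals decide
  rw [a4, b4, c4, d4, e4, f4, a1, i2, i3, i4, hd.1]
  ring

theorem run_progStepU {m b : ℕ} {C : Matrix (Fin (m + 1)) (Fin b) ℝ} {μ : Mem} {d : Fin m → ℝ}
    (h : StoresU μ C d) :
    StoresU (progStepU.run μ).1 C (step C d) ∧
      (progStepU.run μ).2 = 34 + 41 * m + 14 * μ.idx .size 1 := by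
  obtain ⟨hd, hupd⟩ := h
  obtain ⟨a1, a2, -, a4⟩ := run_progCumSum μ
  have a3 := hd.cumSum
  rw [hd.1] at a4
  rw [progStepU, run_seq, run_seq, run_seq]
  generalize progCumSum.run μ = ξ₁ at a1 a2 a3 a4 ⊢
  obtain ⟨d1, d2, d3, d4⟩ := run_resetScores ξ₁.1
  generalize (forUsers (.store .next ctr .zero)).run ξ₁.1 = ξ₂ at d1 d2 d3 d4 ⊢
  obtain ⟨e1, e2, e3, e4⟩ := run_progMulAdd (y := .next) (vals := .updVal) (x := .score)
    (by decide) (by decide) .row .col ξ₂.1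
  generalize (progMulAdd .next .row .updVal .score .col).run ξ₂.1 = ξ₃ at e1 e2 e3 e4 ⊢
  have i2 : ξ₂.1.idx = μ.idx := d1.trans a1
  have i3 : ξ₃.1.idx = μ.idx := e1.trans i2
  have hupd₂ := hupd.congr i2 ((d2 .updVal (by decide)).trans (a2 _ (by decide)))
  have hnext : ∀ i : Fin (m + 1), ξ₃.1.real .next i =
      (rowNormalized C *ᵥ ((colNormalized C)ᵀ *ᵥ (cumMatrix m *ᵥ d))) i := by
    intro i
    rw [e3 i (d3 i (by rw [a1, hd.1]; exact i.isLt)), ← updateMatrix_mulVec]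
    exact hupd₂.sum_row_eq i fun p _ k _ => by rw [d2 _ (by decide), a3]
  obtain ⟨f1, f2, f3, f4⟩ := run_diff_normalize (by rw [i3, hd.1]) hnext
  have hidx := f1.trans i3
  refine ⟨⟨⟨by rw [hidx, hd.1], f3⟩, hupd.congr hidx ?_⟩, ?_⟩
  · rw [f2 _ (by decide) (by decide), e2 _ (by decide), d2 _ (by decide), a2 _ (by decide)]
  · rw [a4, d4, e4, f4, a1, i2, hd.1]
    ring

/-! ### Counting nonzero entries -/

theorem le_nnz {a b : ℕ} {A : Matrix (Fin a) (Fin b) ℝ} (h : ∀ i, ∃ k, A i k ≠ 0) :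
    a ≤ nnz A := by
  choose f hf using h
  have := Nat.card_le_card_of_injective
    (fun i => (⟨(i, f i), hf i⟩ : {q : Fin a × Fin b | A q.1 q.2 ≠ 0}))
    fun i j hij => by simpa using congrArg (fun q => q.1.1) hij
  rwa [Nat.card_fin] at this

theorem exists_ne_zero_of_sum_pos {a b : ℕ} {C : Matrix (Fin a) (Fin b) ℝ} {r : ℝ}
    (hr0 : 0 < r) (hr : ∀ i, ∑ h, C i h = r) (i : Fin a) : ∃ h, C i h ≠ 0 := by
  by_contra! hz
  have := hr i
  simp only [hz, Finset.sum_const_zero] at this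
  exact hr0.ne this

theorem nnz_rowNormalized {a b : ℕ} {C : Matrix (Fin a) (Fin b) ℝ} {r : ℝ} (hr0 : 0 < r)
    (hr : ∀ i, ∑ h, C i h = r) : nnz (rowNormalized C) = nnz C := by
  simp [nnz, rowNormalized_apply hr, hr0.ne']

theorem updateMatrix_self_pos {a b : ℕ} {C : Matrix (Fin a) (Fin b) ℝ} {r : ℝ}
    (hC : ∀ i h, 0 ≤ C i h) (hr0 : 0 < r) (hr : ∀ i, ∑ h, C i h = r) (i : Fin a) :
    0 < updateMatrix C i i := by
  obtain ⟨h, hh⟩ := exists_ne_zero_of_sum_pos hr0 hr i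
  have hpos : 0 < C i h := lt_of_le_of_ne (hC i h) hh.symm
  rw [updateMatrix_apply hr]
  exact Finset.sum_pos' (fun k _ => mul_nonneg (div_nonneg (hC i k) hr0.le)
      (div_nonneg (hC i k) (Finset.sum_nonneg fun j _ => hC j k)))
    ⟨h, Finset.mem_univ _, mul_pos (div_pos hpos hr0) (div_pos hpos
      (Finset.sum_pos' (fun j _ => hC j h) ⟨i, Finset.mem_univ _, hpos⟩))⟩

end HnD

theorem mainTheorem2 :
    ∃ K : ℕ, ∀ (m N : ℕ) (C : Matrix (Fin (m + 1)) (Fin N) ℝ) (r : ℝ),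
      HnD.IsPrePMatrix C → HnD.C1POrderingUnique C → 0 < r → (∀ i, ∑ h, C i h = r) →
      -- outside a proper subspace of initial scores, the iteration converges and its limit, as
      -- well as the output after any sufficiently large number of passes, has the right order
      (∃ W : Submodule ℝ (Fin (m + 1) → ℝ), W ≠ ⊤ ∧ ∀ s₀ : Fin (m + 1) → ℝ, s₀ ∉ W →
        (∃ d : Fin m → ℝ, Tendsto (HnD.diffs C s₀) atTop (𝓝 d) ∧
          ∀ σ : Equiv.Perm (Fin (m + 1)),
            HnD.SortsScores (HnD.cumMatrix m *ᵥ d) σ ↔ HnD.IsC1POrdering C σ) ∧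
        ∃ t₀ : ℕ, ∀ t ≥ t₀, ∀ σ : Equiv.Perm (Fin (m + 1)),
          HnD.SortsScores (HnD.scores C s₀ t) σ ↔ HnD.IsC1POrdering C σ) ∧
      -- the running time of each pass, on the nonzero entries of the response matrix
      (∀ (μ : HnD.Mem) (d : Fin m → ℝ), HnD.Stores μ C d →
        HnD.Stores (HnD.progStep.run μ).1 C (HnD.step C d) ∧
          (HnD.progStep.run μ).2 ≤ K * HnD.nnz C) ∧
      -- the running time of each pass, on the nonzero entries of the update matrix
      (∀ (μ : HnD.Mem) (d : Fin m → ℝ), HnD.StoresU μ C d →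
        HnD.StoresU (HnD.progStepU.run μ).1 C (HnD.step C d) ∧
          (HnD.progStepU.run μ).2 ≤ K * HnD.nnz (HnD.updateMatrix C)) := by
  -- a pass takes `40 + 41 * m + 33 * nnz C` steps, where `m + 1 ≤ nnz C`, and fewer in terms of
  -- `nnz (updateMatrix C)` when the update matrix is given
  refine ⟨74, fun m N C r hC huniq hr0 hr =>
    ⟨HnD.exists_submodule_reconstruction hC huniq hr0 hr, fun μ d h => ?_, fun μ d h => ?_⟩⟩
  · obtain ⟨h1, h2⟩ := HnD.run_progStep h
    refine ⟨h1, ?_⟩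
    have hm := HnD.le_nnz (HnD.exists_ne_zero_of_sum_pos hr0 hr)
    rw [h2, h.2.1.size_eq_nnz, HnD.nnz_rowNormalized hr0 hr]
    omega
  · obtain ⟨h1, h2⟩ := HnD.run_progStepU h
    refine ⟨h1, ?_⟩
    have hC0 : ∀ i h, 0 ≤ C i h := fun i h => by rcases hC.binary i h with h | h <;> simp [h]
    have hm := HnD.le_nnz fun i => ⟨i, (HnD.updateMatrix_self_pos hC0 hr0 hr i).ne'⟩
    rw [h2, h.2.size_eq_nnz]
    omega
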